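/- **Theorem (Metastability of the Curie–Weiss–Potts model).** Let $q\ge 2$ be an integer. For $N\in\mathbb N$ let $\mathcal S_N=\{1,\dots,q\}^N$, let $\widetilde H_N(\sigma)=-\frac1N\sum_{1\le i<j\le N}\mathbf 1_{\{\sigma_i=\sigma_j\}}$, and for $\beta\geq 0$ let $\widetilde\mu_N(\sigma)=e^{-\beta \widetilde H_N(\sigma)}/\widetilde Z_N$ be the Gibbs measure on $\mathcal S_N$. Let $(\widetilde\Sigma^N_t)_{t\in\mathbb N_0}$ be the discrete-time Markov chain on $\mathcal S_N$ with transition probabilities $\widetilde\pi_N(\sigma,\eta)=\frac1{Nq}e^{-\beta[\widetilde H_N(\eta)-\widetilde H_N(\sigma)]_+}$ if $\sigma$ and $\eta$ differ in exactly one coordinate, $\widetilde\pi_N(\sigma,\sigma)=1-\sum_{\eta\ne\sigma}\widetilde\pi_N(\sigma,\eta)$, and $\widetilde\pi_N(\sigma,\eta)=0$ otherwise. Let $\mathbb P_\nu$ denote its law with initial distribution $\nu$, and $\tau_{\mathcal A}=\inf\{t>0:\widetilde\Sigma^N_t\in\mathcal A\}$ (with $\inf\emptyset=\infty$). Let $\mathcal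 P=\{x\in[0,1]^q:\sum_k x_k=1\}$, $\mathcal P_N=\frac1N\mathbb N_0^q\cap\mathcal P$, let $L_N:\mathcal S_N\to\mathcal P_N$, $L_N(\sigma)_k=\frac1N\sum_{i=1}^N\mathbf 1_{\{\sigma_i=k\}}$, be the empirical measure, and for $\beta>0$ let $$\widetilde F_{\beta,q}(x)=-\tfrac12\sum_{k=1}^q x_k^2+\tfrac1\beta\sum_{k=1}^q x_k\log x_k,\qquad x\in\mathcal P ,$$ with $0\log 0=0$. Put $m_0=(1/q,\dots,1/q)$ and let $\beta_1(q)$ be the infimum of all $\beta>0$ for which $\widetilde F_{\beta,q}$ has a local minimum on $\mathcal P$ at a point other than $m_0$. For $i\in\{1,\dots,q\}$ let $m_i\in\mathcal P$ be the point with $i$-th coordinate $(1+(q-1)s)/q$ and all other coordinates $(1-s)/q$, where $s$ is the largest solution of $\log(1+(q-1)s)-\log(1-s)=\beta s$ in $(-\frac{1}{q-1},1)$. Let $\mathcal I_\beta=\{0,1,\dots,q\}$ if $\beta<q$ and $\mathcal I_\beta=\{1,\dots,q\}$ if $\beta\ge q$. Then for every $\beta>\beta_1(q)$ there exist $k_1=k_1(\beta,q)>0$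 and $N_0\in\mathbb N$ such that, for every $N>N_0$ and every choice of points $m_{i,N}\in\mathcal P_N$ at minimal Euclidean distance from $m_i$, $i\in\mathcal I_\beta$, the chain $(\widetilde\Sigma^N_t)$ is $e^{-k_1N}$-metastable with respect to the sets $\mathcal M_{i,N}=L_N^{-1}(m_{i,N})$, $i\in\mathcal I_\beta$. That is, these sets are non-empty and pairwise disjoint and, with $\mathcal M_N=\bigcup_{i\in\mathcal I_\beta}\mathcal M_{i,N}$, $$|\mathcal I_\beta|\,\frac{\max_{j\in\mathcal I_\beta}\mathbb P_{\widetilde\mu_N|\mathcal M_{j,N}}\big[\tau_{\mathcal M_N\setminus\mathcal M_{j,N}}<\tau_{\mathcal M_{j,N}}\big]}{\min_{\emptyset\ne\mathcal X\subset\mathcal S_N\setminus\mathcal M_N}\mathbb P_{\widetilde\mu_N|\mathcal X}\big[\tau_{\mathcal M_N}<\tau_{\mathcal X}\big]}\;\le\;e^{-k_1N},$$ where the minimum is over a non-empty family and is positive, and $\widetilde\mu_N|\mathcal X$ is $\widetilde\mu_N$ conditioned on $\mathcal X$. -/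

import Mathlib

open MeasureTheory ProbabilityTheory
open scoped NNReal ENNReal

noncomputable section

namespace MarkovChain

variable {S : Type} [Fintype S] [DecidableEq S] [MeasurableSpace S] [MeasurableSingletonClass S]

/-- The one-step kernel `σ ↦ ∑ η, P σ η • δ_η` of a stochastic matrix. -/
def stepKernel (P : Matrix.rowStochastic ℝ S) : Kernel S S :=
  Kernel.ofFunOfCountable fun σ => ∑ η, ENNReal.ofReal (P.1 σ η) • Measure.dirac η

instance (P : Matrix.rowStochastic ℝ S) : IsMarkovKernel (stepKernel P) := by
  refine ⟨fun σ => ⟨?_⟩⟩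
  have h1 : ∑ η, P.1 σ η = 1 := Matrix.sum_row_of_mem_rowStochastic P.2 σ
  have h2 : stepKernel P σ = ∑ η, ENNReal.ofReal (P.1 σ η) • Measure.dirac η := rfl
  rw [h2, Measure.finsetSum_apply]
  simp only [Measure.smul_apply, measure_univ, smul_eq_mul, mul_one]
  rw [← ENNReal.ofReal_sum_of_nonneg fun η _ => P.2.1 σ η, h1, ENNReal.ofReal_one]

/-- The law, on the space of trajectories `ℕ → S`, of the time-homogeneous Markov chain with
transition matrix `P` and initial distribution `ν`. -/
def law (P : Matrix.rowStochastic ℝ S) (ν : Measure S) : Measure (ℕ → S) :=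
  Kernel.trajMeasure (X := fun _ => S) ν fun n =>
    (stepKernel P).comap (fun x : (i : Finset.Iic n) → S => x ⟨n, Finset.mem_Iic.2 le_rfl⟩)
      (measurable_pi_apply _)

/-- The first return time `τ_A = inf {t > 0 : ω t ∈ A}`, equal to `⊤` if there is no such `t`. -/
def returnTime (A : Set S) (ω : ℕ → S) : ℕ∞ :=
  ⨅ (t : ℕ) (_ : 0 < t ∧ ω t ∈ A), (t : ℕ∞)

/-- The probability that the chain, started from `μ` conditioned on `A`, reaches `B` before it
returns to `A`, i.e. `ℙ_{μ|A}[τ_B < τ_A]`. -/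
def escapeProb (P : Matrix.rowStochastic ℝ S) (μ : Measure S) (A B : Set S) : ℝ :=
  (law P μ[|A]).real {ω | returnTime B ω < returnTime A ω}

/-- `ρ`-metastability of the chain with transition matrix `P` and invariant measure `μ` with
respect to the finite family of pairwise disjoint non-empty sets `M i`, `i : ι`. The infimum in
the denominator is over the non-empty subsets `X` of the complement of the union of the `M i`;
the supremum and the infimum are over finite types. The denominator is required to be positive, so
that the quotient is a genuine one (and the infimum is not over an empty family). -/
structure IsMetastable {ι : Type} [Fintype ι] (P : Matrix.rowStochastic ℝ S) (μ : Measure S)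
    (ρ : ℝ) (M : ι → Set S) : Prop where
  nonempty : ∀ i, (M i).Nonempty
  disjoint : Pairwise fun i j => Disjoint (M i) (M j)
  denom_pos : 0 < ⨅ X : {X : Set S // X.Nonempty ∧ X ⊆ (⋃ i, M i)ᶜ},
    escapeProb P μ X (⋃ i, M i)
  ratio_le : (Fintype.card ι : ℝ) *
      ((⨆ j, escapeProb P μ (M j) ((⋃ i, M i) \ M j)) /
        ⨅ X : {X : Set S // X.Nonempty ∧ X ⊆ (⋃ i, M i)ᶜ}, escapeProb P μ X (⋃ i, M i)) ≤ ρ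

end MarkovChain

namespace CWP

/-- Spin configurations of `N` spins with `q` colours. -/
abbrev Config (N q : ℕ) : Type := Fin N → Fin q

/-- The mean-field Hamiltonian `-(1/N) ∑_{i<j} 1{σ i = σ j}`. -/
def hamiltonian (N q : ℕ) (σ : Config N q) : ℝ :=
  -(1 / (N : ℝ)) * ∑ i, ∑ j, if i < j ∧ σ i = σ j then (1 : ℝ) else 0

/-- The Gibbs measure at inverse temperature `β`. -/
def gibbs (N q : ℕ) (β : ℝ≥0) : Measure (Config N q) :=
  ∑ σ, ENNReal.ofReal (Real.exp (-β * hamiltonian N q σ) /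
    ∑ η, Real.exp (-β * hamiltonian N q η)) • Measure.dirac σ

/-- The off-diagonal Glauber–Metropolis transition probabilities (and `0` on the diagonal). -/
def flipProb (N q : ℕ) (β : ℝ≥0) (σ η : Config N q) : ℝ :=
  if hammingDist σ η = 1 then
    ((N : ℝ) * q)⁻¹ * Real.exp (-β * max 0 (hamiltonian N q η - hamiltonian N q σ))
  else 0

/-- The Glauber–Metropolis transition probabilities. -/
def glauberMatrix (N q : ℕ) (β : ℝ≥0) : Matrix (Config N q) (Config N q) ℝ := fun σ η =>
  if σ = η then 1 - ∑ ξ ∈ Finset.univ.erase σ, flipProb N q β σ ξ else flipProb N q β σ η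

lemma flipProb_nonneg (N q : ℕ) (β : ℝ≥0) (σ η : Config N q) : 0 ≤ flipProb N q β σ η := by
  unfold flipProb; split_ifs <;> positivity

lemma card_neighbours_le (N q : ℕ) (σ : Config N q) :
    (Finset.univ.filter fun η : Config N q => hammingDist σ η = 1).card ≤ N * q := by
  have h : (Finset.univ.filter fun η : Config N q => hammingDist σ η = 1) ⊆
      (Finset.univ : Finset (Fin N × Fin q)).image fun p => Function.update σ p.1 p.2 := by
    intro η hη
    have hη' : hammingDist σ η = 1 := by simpa using hη
    obtain ⟨i, hi⟩ := Finset.card_eq_one.1 hη'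
    refine Finset.mem_image.2 ⟨(i, η i), Finset.mem_univ _, ?_⟩
    funext k
    by_cases hk : k = i
    · subst hk; simp
    · have : k ∉ Finset.univ.filter fun i => σ i ≠ η i := by rw [hi]; simpa using hk
      simpa [Function.update_of_ne hk] using this
  calc _ ≤ _ := Finset.card_le_card h
    _ ≤ _ := Finset.card_image_le
    _ = N * q := by simp

lemma sum_flipProb_le (N q : ℕ) (β : ℝ≥0) (σ : Config N q) :
    ∑ ξ ∈ Finset.univ.erase σ, flipProb N q β σ ξ ≤ 1 := by
  calc _ ≤ ∑ ξ, flipProb N q β σ ξ :=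
        Finset.sum_le_sum_of_subset_of_nonneg (Finset.erase_subset _ _)
          fun ξ _ _ => flipProb_nonneg N q β σ ξ
    _ ≤ ∑ ξ, if hammingDist σ ξ = 1 then ((N : ℝ) * q)⁻¹ else 0 := by
        refine Finset.sum_le_sum fun ξ _ => ?_
        unfold flipProb
        split_ifs
        · refine mul_le_of_le_one_right (by positivity) (Real.exp_le_one_iff.2 ?_)
          have : 0 ≤ (β : ℝ) * max 0 (hamiltonian N q ξ - hamiltonian N q σ) := by positivity
          linarith
        · exact le_rfl
    _ = ((Finset.univ.filter fun η : Config N q => hammingDist σ η = 1).card : ℝ) *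
          ((N : ℝ) * q)⁻¹ := by rw [← Finset.sum_filter, Finset.sum_const, nsmul_eq_mul]
    _ ≤ ((N : ℝ) * q) * ((N : ℝ) * q)⁻¹ := by
        refine mul_le_mul_of_nonneg_right ?_ (by positivity)
        exact_mod_cast card_neighbours_le N q σ
    _ ≤ 1 := mul_inv_le_one

/-- The Glauber–Metropolis chain, as a stochastic matrix. -/
def glauber (N q : ℕ) (β : ℝ≥0) : Matrix.rowStochastic ℝ (Config N q) :=
  ⟨glauberMatrix N q β, by
    refine Matrix.mem_rowStochastic_iff_sum.2 ⟨fun σ η => ?_, fun σ => ?_⟩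
    · unfold glauberMatrix
      split_ifs
      · linarith [sum_flipProb_le N q β σ]
      · exact flipProb_nonneg N q β σ η
    · rw [← Finset.add_sum_erase _ _ (Finset.mem_univ σ)]
      have : ∑ η ∈ Finset.univ.erase σ, glauberMatrix N q β σ η =
          ∑ η ∈ Finset.univ.erase σ, flipProb N q β σ η :=
        Finset.sum_congr rfl fun η hη => if_neg (Finset.ne_of_mem_erase hη).symm
      rw [this, glauberMatrix, if_pos rfl]
      ring⟩

/-- The empirical measure `L_N`: the vector of relative frequencies of the colours. -/
def empiricalMeasure (N q : ℕ) (σ : Config N q) : Fin q → ℝ := fun k =>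
  1 / (N : ℝ) * ∑ i, if σ i = k then (1 : ℝ) else 0

/-- The lattice `𝒫_N = (1/N) ℕ₀^q ∩ 𝒫`, where `𝒫` is the standard simplex. -/
def latticeSimplex (N q : ℕ) : Set (Fin q → ℝ) :=
  {x ∈ stdSimplex ℝ (Fin q) | ∃ n : Fin q → ℕ, ∀ k, x k = n k / N}

/-- The limiting free energy, to be read on the standard simplex (`0 * log 0 = 0`). -/
def freeEnergy (q : ℕ) (β : ℝ) (x : Fin q → ℝ) : ℝ :=
  -(1 / 2) * ∑ k, x k ^ 2 + 1 / β * ∑ k, x k * Real.log (x k)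

/-- The barycentre `m₀ = (1/q, …, 1/q)`. -/
def barycentre (q : ℕ) : Fin q → ℝ := fun _ => 1 / q

/-- The critical inverse temperature `β₁(q)` above which the free energy has local minima on the
simplex other than the barycentre. -/
def betaOne (q : ℕ) : ℝ :=
  sInf {β : ℝ | 0 < β ∧ ∃ x ∈ stdSimplex ℝ (Fin q), x ≠ barycentre q ∧
    IsLocalMinOn (freeEnergy q β) (stdSimplex ℝ (Fin q)) x}

/-- The largest solution `s` of `log (1 + (q - 1) s) - log (1 - s) = β s`. The solution set lies
below `1`, contains `0`, and has a greatest element for `q ≥ 2`. -/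
def orderParameter (q : ℕ) (β : ℝ) : ℝ :=
  sSup {s : ℝ | 0 < 1 + ((q : ℝ) - 1) * s ∧ 0 < 1 - s ∧
    Real.log (1 + ((q : ℝ) - 1) * s) - Real.log (1 - s) = β * s}

/-- The points `m₀` (index `none`) and `m_i` (index `some i`), `i` a colour. -/
def minimum (q : ℕ) (β : ℝ) : Option (Fin q) → Fin q → ℝ
  | none => barycentre q
  | some i => fun k =>
      if k = i then (1 + ((q : ℝ) - 1) * orderParameter q β) / q
      else (1 - orderParameter q β) / q

/-- The index set `I_β`: all of `{0, …, q}` if `β < q`, and `{1, …, q}` if `β ≥ q`. -/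
def indexSet (q : ℕ) (β : ℝ) : Finset (Option (Fin q)) :=
  if β < q then Finset.univ else Finset.univ.erase none

/-- `y` is a closest point of the lattice `𝒫_N` to `x`, in Euclidean distance. -/
def IsClosestLatticePoint (N q : ℕ) (x y : Fin q → ℝ) : Prop :=
  y ∈ latticeSimplex N q ∧
    ∀ z ∈ latticeSimplex N q, ∑ k, (y k - x k) ^ 2 ≤ ∑ k, (z k - x k) ^ 2

end CWP

end

/-!
By reversibility, `ℙ_{μ|A}[τ_B < τ_A] * μ(A)` is the capacity of `(A, B)`, so both escape
probabilities become variational quantities.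

*Leaving a metastable set.* The Dirichlet principle with the indicator of a ball around `m_j` as
test function bounds the capacity by the mass of a thin shell. By Stirling's formula colour classes
have mass `e^{-βNF}` up to polynomial factors, and `m_j` is a strict local minimum of the free
energy `F`, so this is exponentially smaller than the mass of the metastable set.

*Reaching the metastable sets.* From any configuration, flipping one spin at a time, one descends
along the level sets of `F`, up to an error `ε`, to a near-minimiser on the lattice; for large `N`
it is close to a local minimum of `F`, and these are exactly the `m_i`. Averaging such a path over
all permutations of the sites spreads its start over a whole colour class, and the Cauchy–Schwarz
inequality along it bounds the capacity below by the mass of the class times `e^{-βNε}`, up to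
polynomial factors.

*Local minima of `F`.* At an interior critical point the coordinates take at most two values, and
the second-order condition forbids the larger one to occur twice, so a local minimum lies on a ray
from the barycentre to a vertex, where `F` is a function of the one variable `s`.
-/

namespace MarkovChain

section ReturnTime

variable {S : Type} {A B : Set S} {n : ℕ} {ω : ℕ → S}

lemma coe_lt_returnTime_iff : n < returnTime A ω ↔ ∀ t, 0 < t → t ≤ n → ω t ∉ A := by
  rw [← not_le, returnTime]
  constructor
  · exact fun h t h0 htn hA => h (iInf₂_le_of_le t ⟨h0, hA⟩ (by exact_mod_cast htn))
  · intro h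
    rw [not_le, ← ENat.add_one_le_iff (ENat.natCast_ne_top n)]
    refine le_iInf₂ fun t ht => ?_
    have : n < t := not_le.1 fun htn => h t ht.1 htn ht.2
    exact_mod_cast this

lemma coe_zero_lt_returnTime : ((0 : ℕ) : ℕ∞) < returnTime A ω :=
  coe_lt_returnTime_iff.2 fun _ h0 h1 => absurd h0 h1.not_gt

lemma coe_succ_lt_returnTime_iff :
    ((n + 1 : ℕ) : ℕ∞) < returnTime A ω ↔ n < returnTime A ω ∧ ω (n + 1) ∉ A := by
  simp only [coe_lt_returnTime_iff, Nat.le_succ_iff_eq_or_le]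
  grind

lemma returnTime_union : returnTime (A ∪ B) ω = returnTime A ω ⊓ returnTime B ω := by
  simp only [returnTime, Set.mem_union, and_or_left, iInf_or, iInf_inf_eq]

lemma returnTime_lt_returnTime_iff (hAB : Disjoint A B) :
    returnTime B ω < returnTime A ω ↔ ∃ n : ℕ, n < returnTime (A ∪ B) ω ∧ ω (n + 1) ∈ B := by
  simp only [returnTime_union, lt_inf_iff]
  constructor
  · intro h
    obtain ⟨m, hm⟩ := ENat.ne_top_iff_exists.1 h.ne_top
    obtain _ | n := m
    · exact absurd hm coe_zero_lt_returnTime.ne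
    have hn : (n : ℕ∞) < returnTime B ω := hm ▸ by exact_mod_cast n.lt_succ_self
    refine ⟨n, ⟨hn.trans h, hn⟩, ?_⟩
    by_contra hB
    exact hm.not_lt (coe_succ_lt_returnTime_iff.2 ⟨hn, hB⟩)
  · rintro ⟨n, ⟨hA, _⟩, hB⟩
    calc returnTime B ω ≤ (n + 1 : ℕ) :=
          not_lt.1 fun h => (coe_succ_lt_returnTime_iff.1 h).2 hB
      _ < returnTime A ω := coe_succ_lt_returnTime_iff.2 ⟨hA, hAB.notMem_of_mem_right hB⟩

lemma exists_lt_returnTime_eq_preimage (A : Set S) (n : ℕ) :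
    ∃ D : Set (Finset.Iic n → S),
      {ω | n < returnTime A ω} = Preorder.frestrictLe (π := fun _ => S) n ⁻¹' D :=
  ⟨{x | ∀ t (_ : 0 < t) (h : t ≤ n), x ⟨t, Finset.mem_Iic.2 h⟩ ∉ A}, by
    ext ω; exact coe_lt_returnTime_iff⟩

lemma measurableSet_lt_returnTime_succ_mem [Finite S] [MeasurableSpace S]
    [MeasurableSingletonClass S] (C B : Set S) (n : ℕ) :
    MeasurableSet {ω : ℕ → S | n < returnTime C ω ∧ ω (n + 1) ∈ B} := by
  obtain ⟨D, hD⟩ := exists_lt_returnTime_eq_preimage C n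
  have hC : MeasurableSet {ω : ℕ → S | n < returnTime C ω} :=
    hD ▸ Preorder.measurable_frestrictLe (X := fun _ => S) n (Set.toFinite D).measurableSet
  exact hC.inter (measurable_pi_apply (n + 1) (Set.toFinite B).measurableSet)

end ReturnTime

section Law

/-- The substochastic transition matrix of the chain killed on entering `C`. -/
noncomputable def killedMatrix {S : Type} [Fintype S] [DecidableEq S]
    (P : Matrix.rowStochastic ℝ S) (C : Set S) : Matrix S S ℝ :=
  fun ξ => Cᶜ.indicator (P.1 ξ)

variable {S : Type} [Fintype S] [DecidableEq S] [MeasurableSpace S] [MeasurableSingletonClass S]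

lemma stepKernel_real_apply (P : Matrix.rowStochastic ℝ S) (ξ : S) (B : Set S) :
    (stepKernel P ξ).real B = ∑ η, B.indicator (P.1 ξ) η := by
  classical
  have h : stepKernel P ξ = ∑ η, ENNReal.ofReal (P.1 ξ η) • Measure.dirac η := rfl
  rw [Measure.real, h, Measure.finsetSum_apply, ENNReal.toReal_sum]
  · refine Finset.sum_congr rfl fun η _ => ?_
    by_cases hη : η ∈ B <;> simp [hη, P.2.1 ξ η, (Set.toFinite B).measurableSet]
  · exact fun η _ => by
      simpa using ENNReal.mul_ne_top ENNReal.ofReal_ne_top (measure_ne_top (Measure.dirac η) B)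

variable (P : Matrix.rowStochastic ℝ S) (ν : Measure S)

lemma law_coord_zero (ξ : S) : law P ν {ω | ω 0 = ξ} = ν {ξ} := by
  have h : (law P ν).map (Preorder.frestrictLe 0) =
      ν.map (MeasurableEquiv.piUnique (fun _ : Finset.Iic 0 => S)).symm := by
    rw [law, Kernel.trajMeasure, Measure.map_comp _ _ (by fun_prop),
      Kernel.traj_map_frestrictLe, Kernel.partialTraj_self, Measure.id_comp]
  have hm : MeasurableSet {x : Finset.Iic 0 → S | x ⟨0, by simp⟩ = ξ} :=
    (Set.toFinite _).measurableSet
  change law P ν (Preorder.frestrictLe (π := fun _ => S) 0 ⁻¹' {x | x ⟨0, by simp⟩ = ξ}) = _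
  rw [← Measure.map_apply (by fun_prop) hm, h, Measure.map_apply (by fun_prop) hm]
  rfl

variable [IsProbabilityMeasure ν]

instance : IsProbabilityMeasure (law P ν) := by
  unfold law; infer_instance

lemma law_markovProperty (n : ℕ) (D : Set (Finset.Iic n → S)) (ξ : S) (B : Set S) :
    law P ν {ω | (Preorder.frestrictLe n ω ∈ D ∧ ω n = ξ) ∧ ω (n + 1) ∈ B} =
      law P ν {ω | Preorder.frestrictLe n ω ∈ D ∧ ω n = ξ} * stepKernel P ξ B := by
  set E : Set (Finset.Iic n → S) := {x | x ∈ D ∧ x ⟨n, by simp⟩ = ξ}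
  have hE : MeasurableSet E := (Set.toFinite _).measurableSet
  have hB : MeasurableSet B := (Set.toFinite _).measurableSet
  have key := Kernel.map_frestrictLe_trajMeasure_compProd_eq_map_trajMeasure (X := fun _ => S)
    (μ₀ := ν) (κ := fun n => (stepKernel P).comap
      (fun x : Finset.Iic n → S => x ⟨n, Finset.mem_Iic.2 le_rfl⟩) (measurable_pi_apply _))
    (a := n)
  change law P ν ((fun ω : ℕ → S => (Preorder.frestrictLe (π := fun _ => S) n ω, ω (n + 1))) ⁻¹'
    E ×ˢ B) = law P ν (Preorder.frestrictLe (π := fun _ => S) n ⁻¹' E) * _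
  rw [← Measure.map_apply (by fun_prop) (hE.prod hB), ← Measure.map_apply (by fun_prop) hE, law,
    ← key, Measure.compProd_apply_prod hE hB,
    setLIntegral_congr_fun (g := fun _ => stepKernel P ξ B) hE, setLIntegral_const, mul_comm]
  intro x hx
  simp only [Kernel.comap_apply]
  rw [show x ⟨n, by simp⟩ = ξ from hx.2]

lemma law_real_lt_returnTime_succ_mem (C B : Set S) (n : ℕ) :
    (law P ν).real {ω | n < returnTime C ω ∧ ω (n + 1) ∈ B} =
      ∑ ξ, (law P ν).real {ω | n < returnTime C ω ∧ ω n = ξ} * (stepKernel P ξ).real B := by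
  obtain ⟨D, hD⟩ := exists_lt_returnTime_eq_preimage C n
  have mem_D (ω : ℕ → S) : n < returnTime C ω ↔ Preorder.frestrictLe n ω ∈ D :=
    Set.ext_iff.1 hD ω
  rw [← measureReal_restrict_apply_univ, ← Set.preimage_univ (f := fun ω : ℕ → S => ω n),
    ← Finset.coe_univ, ← sum_measureReal_preimage_singleton _
      fun ξ _ => measurable_pi_apply n (measurableSet_singleton ξ)]
  refine Finset.sum_congr rfl fun ξ _ => ?_
  rw [measureReal_restrict_apply (measurable_pi_apply n (measurableSet_singleton ξ))]
  simp only [mem_D, Measure.real, ← ENNReal.toReal_mul, ← law_markovProperty]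
  congr 2
  ext ω
  simp only [Set.mem_inter_iff, Set.mem_preimage, Set.mem_singleton_iff, Set.mem_ofPred_eq]
  tauto

lemma stepKernel_real_singleton_diff (C : Set S) (ξ η : S) :
    (stepKernel P ξ).real ({η} \ C) = killedMatrix P C ξ η := by
  rw [stepKernel_real_apply, Finset.sum_eq_single η (fun ζ _ h => by simp [h]) (by simp)]
  by_cases hη : η ∈ C <;> simp [killedMatrix, hη]

open Matrix in
lemma law_real_lt_returnTime_coord_eq (C : Set S) (n : ℕ) (ξ : S) :
    (law P ν).real {ω | n < returnTime C ω ∧ ω n = ξ} =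
      ((fun σ => ν.real {σ}) ᵥ* killedMatrix P C ^ n) ξ := by
  induction n generalizing ξ with
  | zero =>
    simp only [coe_zero_lt_returnTime, true_and, pow_zero, vecMul_one]
    rw [Measure.real, law_coord_zero, Measure.real]
  | succ n ih =>
    have hsplit : {ω : ℕ → S | ((n + 1 : ℕ) : ℕ∞) < returnTime C ω ∧ ω (n + 1) = ξ} =
        {ω | n < returnTime C ω ∧ ω (n + 1) ∈ ({ξ} \ C : Set S)} := by
      ext ω
      simp only [coe_succ_lt_returnTime_iff, Set.mem_ofPred_eq, Set.mem_sdiff,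
        Set.mem_singleton_iff]
      tauto
    rw [hsplit, law_real_lt_returnTime_succ_mem, pow_succ, ← vecMul_vecMul]
    simp only [ih, stepKernel_real_singleton_diff]
    rfl

open Matrix in
lemma hasSum_law_real_returnTime_lt {A B : Set S} (hAB : Disjoint A B) :
    HasSum (fun n => (fun σ => ν.real {σ}) ⬝ᵥ
        (killedMatrix P (A ∪ B) ^ n *ᵥ fun ξ => (stepKernel P ξ).real B))
      ((law P ν).real {ω | returnTime B ω < returnTime A ω}) := by
  set E : ℕ → Set (ℕ → S) := fun n => {ω | n < returnTime (A ∪ B) ω ∧ ω (n + 1) ∈ B}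
  have hE (n : ℕ) : MeasurableSet (E n) := measurableSet_lt_returnTime_succ_mem _ B n
  have hdisj : Pairwise (Function.onFun Disjoint E) := by
    refine (pairwise_disjoint_on E).2 fun m n hmn => Set.disjoint_left.2 fun ω hm hn => ?_
    exact coe_lt_returnTime_iff.1 hn.1 (m + 1) m.succ_pos hmn (Or.inr hm.2)
  have hunion : {ω | returnTime B ω < returnTime A ω} = ⋃ n, E n := by
    ext ω; simp [E, returnTime_lt_returnTime_iff hAB]
  have hterm (n : ℕ) : (law P ν).real (E n) = (fun σ => ν.real {σ}) ⬝ᵥ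
      (killedMatrix P (A ∪ B) ^ n *ᵥ fun ξ => (stepKernel P ξ).real B) := by
    simp only [E, law_real_lt_returnTime_succ_mem, law_real_lt_returnTime_coord_eq,
      dotProduct_mulVec]
    rfl
  have hsum := measure_iUnion (μ := law P ν) hdisj hE
  have h : HasSum (fun n => (law P ν).real (E n)) ((law P ν).real (⋃ n, E n)) := by
    rw [Measure.real, hsum, ENNReal.tsum_toReal_eq fun n => measure_ne_top _ _]
    exact (ENNReal.summable_toReal (hsum ▸ measure_ne_top _ _)).hasSum
  simpa only [hterm, ← hunion] using h

end Law

section Potential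

variable {S : Type} [Fintype S] [DecidableEq S] [MeasurableSpace S] [MeasurableSingletonClass S]
  (P : Matrix.rowStochastic ℝ S) {A B : Set S}

/-- The probability that the chain started at `σ` visits `B` at a positive time before `A`. -/
noncomputable def reachProb (A B : Set S) (σ : S) : ℝ :=
  (law P (Measure.dirac σ)).real {ω | returnTime B ω < returnTime A ω}

open Classical in
/-- The equilibrium potential of `B` against `A`: the probability of reaching `B` before `A`, where
time `0` counts. -/
noncomputable def potential (A B : Set S) (σ : S) : ℝ :=
  if σ ∈ A then 0 else if σ ∈ B then 1 else reachProb P A B σ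

lemma potential_of_mem_left {σ : S} (h : σ ∈ A) : potential P A B σ = 0 := if_pos h

lemma potential_of_mem_right (hAB : Disjoint A B) {σ : S} (h : σ ∈ B) :
    potential P A B σ = 1 := by
  simp [potential, h, hAB.notMem_of_mem_right h]

open Matrix in
lemma hasSum_reachProb (hAB : Disjoint A B) (σ : S) :
    HasSum (fun n => (killedMatrix P (A ∪ B) ^ n *ᵥ fun ξ => (stepKernel P ξ).real B) σ)
      (reachProb P A B σ) := by
  have hdirac : (fun τ => (Measure.dirac σ).real {τ}) = Pi.single σ 1 := by
    ext τ
    rcases eq_or_ne τ σ with rfl | h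
    · simp [Measure.real]
    · simp [Measure.real, h, h.symm]
  simpa only [hdirac, single_one_dotProduct, reachProb] using
    hasSum_law_real_returnTime_lt P (Measure.dirac σ) hAB

/-- One-step analysis: shifting the series for `reachProb` by one index conditions on the first
step. -/
lemma reachProb_eq_sum_mul_potential (hAB : Disjoint A B) (σ : S) :
    reachProb P A B σ = ∑ η, P.1 σ η * potential P A B η := by
  have hshift : HasSum
      (fun n => (killedMatrix P (A ∪ B) ^ (n + 1)).mulVec (fun ξ => (stepKernel P ξ).real B) σ)
      (∑ η, killedMatrix P (A ∪ B) σ η * reachProb P A B η) := by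
    simp only [pow_succ', ← Matrix.mulVec_mulVec]
    exact hasSum_sum fun η _ => (hasSum_reachProb P hAB η).mul_left _
  have hfirst : reachProb P A B σ =
      (stepKernel P σ).real B + ∑ η, killedMatrix P (A ∪ B) σ η * reachProb P A B η := by
    have := ((hasSum_nat_add_iff' 1).2 (hasSum_reachProb P hAB σ)).unique hshift
    simp only [Finset.range_one, Finset.sum_singleton, pow_zero, Matrix.one_mulVec] at this
    linarith
  rw [hfirst, stepKernel_real_apply, ← Finset.sum_add_distrib]
  refine Finset.sum_congr rfl fun η _ => ?_
  by_cases hA : η ∈ A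
  · simp [killedMatrix, potential, hA, hAB.notMem_of_mem_left hA]
  · by_cases hB : η ∈ B <;> simp [killedMatrix, potential, hA, hB]

lemma potential_eq_sum_mul_potential (hAB : Disjoint A B) {σ : S} (hA : σ ∉ A) (hB : σ ∉ B) :
    potential P A B σ = ∑ η, P.1 σ η * potential P A B η := by
  rw [← reachProb_eq_sum_mul_potential P hAB]
  simp [potential, hA, hB]

lemma law_real_returnTime_lt_eq_sum (ν : Measure S) [IsProbabilityMeasure ν]
    (hAB : Disjoint A B) :
    (law P ν).real {ω | returnTime B ω < returnTime A ω} =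
      ∑ σ, ν.real {σ} * ∑ η, P.1 σ η * potential P A B η := by
  simp only [← reachProb_eq_sum_mul_potential P hAB]
  exact (hasSum_law_real_returnTime_lt P ν hAB).unique
    (hasSum_sum fun σ _ => (hasSum_reachProb P hAB σ).mul_left _)

end Potential

section DirichletForm

variable {S : Type} [Fintype S] [DecidableEq S]

/-- The Dirichlet form of the chain with transition matrix `P`, with respect to the weights `w`. -/
noncomputable def dirichletForm (P : Matrix.rowStochastic ℝ S) (w u v : S → ℝ) : ℝ :=
  1 / 2 * ∑ σ, ∑ η, w σ * P.1 σ η * ((u σ - u η) * (v σ - v η))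

/-- Detailed balance of the transition matrix `P` with respect to the weights `w`. -/
def IsReversible (P : Matrix.rowStochastic ℝ S) (w : S → ℝ) : Prop :=
  ∀ σ η, w σ * P.1 σ η = w η * P.1 η σ

variable {P : Matrix.rowStochastic ℝ S} {w : S → ℝ}

lemma dirichletForm_self_nonneg (hw : ∀ σ, 0 ≤ w σ) (u : S → ℝ) : 0 ≤ dirichletForm P w u u :=
  mul_nonneg (by norm_num) <| Finset.sum_nonneg fun σ _ => Finset.sum_nonneg fun η _ =>
    mul_nonneg (mul_nonneg (hw σ) (P.2.1 σ η)) (mul_self_nonneg _)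

lemma dirichletForm_add_self_add (u v : S → ℝ) :
    dirichletForm P w (u + v) (u + v) =
      dirichletForm P w u u + 2 * dirichletForm P w u v + dirichletForm P w v v := by
  simp only [dirichletForm, Finset.mul_sum, ← Finset.sum_add_distrib, Pi.add_apply]
  exact Finset.sum_congr rfl fun σ _ => Finset.sum_congr rfl fun η _ => by ring

/-- Green's identity. -/
lemma dirichletForm_eq_sum (hw : IsReversible P w) (u v : S → ℝ) :
    dirichletForm P w u v = ∑ σ, w σ * v σ * (u σ - ∑ η, P.1 σ η * u η) := by
  have hσ : ∑ σ, ∑ η, w σ * P.1 σ η * ((u σ - u η) * v σ) =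
      ∑ σ, w σ * v σ * (u σ - ∑ η, P.1 σ η * u η) := by
    refine Finset.sum_congr rfl fun σ _ => ?_
    have hrow : u σ = ∑ η, P.1 σ η * u σ := by
      rw [← Finset.sum_mul, Matrix.sum_row_of_mem_rowStochastic P.2, one_mul]
    conv_rhs => rw [hrow, ← Finset.sum_sub_distrib, Finset.mul_sum]
    exact Finset.sum_congr rfl fun η _ => by ring
  have hη : ∑ σ, ∑ η, w σ * P.1 σ η * ((u σ - u η) * v η) =
      -∑ σ, ∑ η, w σ * P.1 σ η * ((u σ - u η) * v σ) := by
    rw [Finset.sum_comm]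
    simp only [← Finset.sum_neg_distrib]
    refine Finset.sum_congr rfl fun σ _ => Finset.sum_congr rfl fun η _ => ?_
    rw [hw η σ]; ring
  simp only [dirichletForm, mul_sub, Finset.sum_sub_distrib] at hσ hη ⊢
  linarith

end DirichletForm

section Capacity

variable {S : Type} [Fintype S] [DecidableEq S] [MeasurableSpace S] [MeasurableSingletonClass S]

/-- The capacity of the condenser `(A, B)`: the Dirichlet energy of its equilibrium potential. -/
noncomputable def capacity (P : Matrix.rowStochastic ℝ S) (w : S → ℝ) (A B : Set S) : ℝ :=
  dirichletForm P w (potential P A B) (potential P A B)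

variable {P : Matrix.rowStochastic ℝ S} {w : S → ℝ} {A B : Set S}

lemma dirichletForm_potential_eq_zero (hw : IsReversible P w) (hAB : Disjoint A B) {v : S → ℝ}
    (hv : ∀ σ ∈ A ∪ B, v σ = 0) : dirichletForm P w (potential P A B) v = 0 := by
  rw [dirichletForm_eq_sum hw]
  refine Finset.sum_eq_zero fun σ _ => ?_
  by_cases h : σ ∈ A ∪ B
  · rw [hv σ h, mul_zero, zero_mul]
  · rw [Set.mem_union, not_or] at h
    rw [← potential_eq_sum_mul_potential P hAB h.1 h.2, sub_self, mul_zero]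

/-- The Dirichlet principle. -/
lemma capacity_le_dirichletForm (hw : IsReversible P w) (hw0 : ∀ σ, 0 ≤ w σ)
    (hAB : Disjoint A B) {v : S → ℝ} (hvA : ∀ σ ∈ A, v σ = 0) (hvB : ∀ σ ∈ B, v σ = 1) :
    capacity P w A B ≤ dirichletForm P w v v := by
  set u := potential P A B with hu
  have hzero : dirichletForm P w u (v - u) = 0 := by
    refine dirichletForm_potential_eq_zero hw hAB fun σ hσ => ?_
    rcases hσ with hσ | hσ
    · simp [hu, hvA σ hσ, potential_of_mem_left P hσ]
    · simp [hu, hvB σ hσ, potential_of_mem_right P hAB hσ]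
  calc capacity P w A B ≤ capacity P w A B + dirichletForm P w (v - u) (v - u) :=
        le_add_of_nonneg_right (dirichletForm_self_nonneg hw0 _)
    _ = dirichletForm P w (u + (v - u)) (u + (v - u)) := by
        rw [dirichletForm_add_self_add, hzero, mul_zero, add_zero, capacity]
    _ = dirichletForm P w v v := by rw [add_sub_cancel]

open Classical in
lemma capacity_eq_sum_mul_flux (hw : IsReversible P w) (hAB : Disjoint A B) :
    capacity P w A B =
      ∑ σ, if σ ∈ A then w σ * ∑ η, P.1 σ η * potential P A B η else 0 := by
  set u := potential P A B with hu
  have hzero : dirichletForm P w u (u - 1 + A.indicator 1) = 0 := by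
    refine dirichletForm_potential_eq_zero hw hAB fun σ hσ => ?_
    rcases hσ with hσ | hσ
    · simp [hu, hσ, potential_of_mem_left P hσ]
    · simp [hu, potential_of_mem_right P hAB hσ, hAB.notMem_of_mem_right hσ]
  have hsplit : dirichletForm P w u (u - 1 + A.indicator 1) =
      capacity P w A B + dirichletForm P w u (A.indicator 1) := by
    simp only [capacity, dirichletForm, ← mul_add, ← Finset.sum_add_distrib, Pi.add_apply,
      Pi.sub_apply, Pi.one_apply]
    congr! 3
    ring
  rw [hzero, dirichletForm_eq_sum hw, eq_comm, ← eq_neg_iff_add_eq_zero] at hsplit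
  rw [hsplit, ← Finset.sum_neg_distrib]
  refine Finset.sum_congr rfl fun σ _ => ?_
  by_cases hσ : σ ∈ A
  · simp [hσ, hu, potential_of_mem_left P hσ]
  · simp [hσ]

lemma escapeProb_mul_real_eq_capacity (μ : Measure S) [IsFiniteMeasure μ]
    (hw : IsReversible P fun σ => μ.real {σ}) (hAB : Disjoint A B) (hA : μ A ≠ 0) :
    escapeProb P μ A B * μ.real A = capacity P (fun σ => μ.real {σ}) A B := by
  classical
  have := cond_isProbabilityMeasure (μ := μ) hA
  have hAm : MeasurableSet A := (Set.toFinite A).measurableSet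
  have hpos : μ.real A ≠ 0 := (measureReal_ne_zero_iff).2 hA
  rw [escapeProb, law_real_returnTime_lt_eq_sum P _ hAB, capacity_eq_sum_mul_flux hw hAB,
    Finset.sum_mul]
  refine Finset.sum_congr rfl fun σ _ => ?_
  have hcond : μ[|A].real {σ} = (μ.real A)⁻¹ * μ.real (A ∩ {σ}) := by
    simp only [Measure.real, cond_apply hAm, ENNReal.toReal_mul, ENNReal.toReal_inv]
  by_cases hσ : σ ∈ A
  · rw [hcond, Set.inter_eq_right.2 (Set.singleton_subset_iff.2 hσ), if_pos hσ]
    field_simp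
  · rw [hcond, Set.inter_singleton_eq_empty.2 hσ]
    simp [hσ]

end Capacity

lemma isMetastable_of_escapeProb_le {S ι : Type} [Fintype S] [DecidableEq S]
    [MeasurableSpace S] [MeasurableSingletonClass S] [Fintype ι]
    {P : Matrix.rowStochastic ℝ S} {μ : Measure S} {M : ι → Set S}
    (hM : ∀ i, (M i).Nonempty) (hdisj : Pairwise fun i j => Disjoint (M i) (M j))
    (hcompl : (⋃ i, M i)ᶜ.Nonempty) {a b ρ : ℝ} (ha : 0 ≤ a) (hb : 0 < b)
    (hout : ∀ j, escapeProb P μ (M j) ((⋃ i, M i) \ M j) ≤ a)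
    (hin : ∀ X : Set S, X.Nonempty → X ⊆ (⋃ i, M i)ᶜ → b ≤ escapeProb P μ X (⋃ i, M i))
    (hρ : Fintype.card ι * (a / b) ≤ ρ) : IsMetastable P μ ρ M := by
  have : Nonempty {X : Set S // X.Nonempty ∧ X ⊆ (⋃ i, M i)ᶜ} := ⟨⟨_, hcompl, subset_rfl⟩⟩
  have hinf : b ≤ ⨅ X : {X : Set S // X.Nonempty ∧ X ⊆ (⋃ i, M i)ᶜ},
      escapeProb P μ X (⋃ i, M i) := le_ciInf fun X => hin X X.2.1 X.2.2
  refine ⟨hM, hdisj, hb.trans_le hinf, le_trans ?_ hρ⟩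
  gcongr
  exact Real.iSup_le hout ha

end MarkovChain

namespace CWP

open Set Filter Topology

/-- The contribution of one coordinate to `β` times the free energy. -/
noncomputable def siteEnergy (β t : ℝ) : ℝ := t * Real.log t - β / 2 * t ^ 2

lemma continuous_siteEnergy (β : ℝ) : Continuous (siteEnergy β) :=
  Real.continuous_mul_log.sub (by fun_prop)

lemma freeEnergy_eq (q : ℕ) {β : ℝ} (hβ : 0 < β) (x : Fin q → ℝ) :
    freeEnergy q β x = 1 / β * ∑ k, siteEnergy β (x k) := by
  simp only [freeEnergy, siteEnergy, Finset.sum_sub_distrib, ← Finset.mul_sum]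
  field_simp
  ring

lemma continuous_freeEnergy (q : ℕ) (β : ℝ) : Continuous (freeEnergy q β) := by
  unfold freeEnergy
  refine (by fun_prop : Continuous _).add (continuous_const.mul ?_)
  exact continuous_finsetSum _ fun k _ => Real.continuous_mul_log.comp (continuous_apply k)

lemma hasDerivAt_siteEnergy (β : ℝ) {t : ℝ} (ht : 0 < t) :
    HasDerivAt (siteEnergy β) (Real.log t - β * t + 1) t := by
  have hlog := Real.hasDerivAt_mul_log ht.ne'
  have hsq : HasDerivAt (fun t : ℝ => β / 2 * t ^ 2) (β / 2 * (2 * t)) t := by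
    simpa using (hasDerivAt_pow 2 t).const_mul (β / 2)
  exact (hlog.sub hsq).congr_deriv (by ring)

lemma hasDerivAt_log_sub_mul (β : ℝ) {t : ℝ} (ht : 0 < t) :
    HasDerivAt (fun t => Real.log t - β * t) (t⁻¹ - β) t :=
  ((Real.hasDerivAt_log ht.ne').sub ((hasDerivAt_id t).const_mul β)).congr_deriv (by simp)

lemma strictMonoOn_log_sub_mul {β : ℝ} (hβ : 0 < β) :
    StrictMonoOn (fun t => Real.log t - β * t) (Ioc 0 (1 / β)) := by
  refine strictMonoOn_of_deriv_pos (convex_Ioc _ _)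
    (fun t ht => (hasDerivAt_log_sub_mul β ht.1).continuousAt.continuousWithinAt) fun t ht => ?_
  rw [interior_Ioc] at ht
  rw [(hasDerivAt_log_sub_mul β ht.1).deriv, sub_pos, lt_inv_comm₀ hβ ht.1, inv_eq_one_div]
  exact ht.2

lemma strictAntiOn_log_sub_mul {β : ℝ} (hβ : 0 < β) :
    StrictAntiOn (fun t => Real.log t - β * t) (Ici (1 / β)) := by
  have hpos : ∀ t ∈ Ici (1 / β), 0 < t := fun t ht => lt_of_lt_of_le (by positivity) ht
  refine strictAntiOn_of_deriv_neg (convex_Ici _)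
    (fun t ht => (hasDerivAt_log_sub_mul β (hpos t ht)).continuousAt.continuousWithinAt)
      fun t ht => ?_
  rw [interior_Ici] at ht
  have h0 := hpos t (Ioi_subset_Ici_self ht)
  rw [(hasDerivAt_log_sub_mul β h0).deriv, sub_neg, inv_lt_comm₀ h0 hβ, inv_eq_one_div]
  exact ht

lemma lt_and_lt_of_log_sub_mul_eq {β : ℝ} (hβ : 0 < β) {u v : ℝ} (hu : 0 < u) (huv : u < v)
    (h : Real.log u - β * u = Real.log v - β * v) : u < 1 / β ∧ 1 / β < v := by
  constructor
  · by_contra! hc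
    exact absurd h (ne_of_gt (strictAntiOn_log_sub_mul hβ hc (hc.trans huv.le) huv))
  · by_contra! hc
    exact absurd h (ne_of_lt (strictMonoOn_log_sub_mul hβ ⟨hu, huv.le.trans hc⟩
      ⟨hu.trans huv, hc⟩ huv))

lemma strictConvexOn_siteEnergy {β : ℝ} (hβ : 0 < β) :
    StrictConvexOn ℝ (Icc 0 (1 / β)) (siteEnergy β) := by
  refine StrictMonoOn.strictConvexOn_of_deriv (convex_Icc _ _)
    (continuous_siteEnergy β).continuousOn ?_
  rw [interior_Icc]
  intro s hs t ht hst
  rw [(hasDerivAt_siteEnergy β hs.1).deriv, (hasDerivAt_siteEnergy β ht.1).deriv]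
  simpa using strictMonoOn_log_sub_mul hβ ⟨hs.1, hs.2.le⟩ ⟨ht.1, ht.2.le⟩ hst

lemma strictConcaveOn_siteEnergy {β : ℝ} (hβ : 0 < β) :
    StrictConcaveOn ℝ (Ici (1 / β)) (siteEnergy β) := by
  refine StrictAntiOn.strictConcaveOn_of_deriv (convex_Ici _)
    (continuous_siteEnergy β).continuousOn ?_
  rw [interior_Ici]
  have h0 : 0 < 1 / β := by positivity
  intro s hs t ht hst
  rw [(hasDerivAt_siteEnergy β (h0.trans hs)).deriv, (hasDerivAt_siteEnergy β (h0.trans ht)).deriv]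
  simpa using strictAntiOn_log_sub_mul hβ (Ioi_subset_Ici_self hs) (Ioi_subset_Ici_self ht) hst

section MeanField

/-- The mean-field function, with `c = q - 1`: the mean-field equation of the model is
`meanField c β s = 0`. -/
noncomputable def meanField (c β s : ℝ) : ℝ := Real.log (1 + c * s) - Real.log (1 - s) - β * s

/-- The point where the mean-field function turns from concave to convex on `[0, 1)`. -/
noncomputable def inflectionPoint (c : ℝ) : ℝ := (c - 1) / (2 * c)

variable {c β s t : ℝ}

lemma inflectionPoint_nonneg (hc : 1 ≤ c) : 0 ≤ inflectionPoint c :=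
  div_nonneg (by linarith) (by linarith)

lemma inflectionPoint_lt_one (hc : 0 < c) : inflectionPoint c < 1 := by
  rw [inflectionPoint, div_lt_one (by positivity)]; linarith

lemma strictMonoOn_one_add_mul_one_sub (hc : 0 < c) :
    StrictMonoOn (fun s : ℝ => (1 + c * s) * (1 - s)) (Iic (inflectionPoint c)) := by
  intro s _ t ht hst
  have ht' : t * (2 * c) ≤ c - 1 := (le_div_iff₀ (by positivity)).1 ht
  have hpos : 0 < c - 1 - c * (s + t) := by nlinarith
  nlinarith [mul_pos (sub_pos.2 hst) hpos]

lemma strictAntiOn_one_add_mul_one_sub (hc : 0 < c) :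
    StrictAntiOn (fun s : ℝ => (1 + c * s) * (1 - s)) (Ici (inflectionPoint c)) := by
  intro s hs t _ hst
  have hs' : c - 1 ≤ s * (2 * c) := (div_le_iff₀ (by positivity)).1 hs
  have hpos : 0 < c * (s + t) - (c - 1) := by nlinarith
  nlinarith [mul_pos (sub_pos.2 hst) hpos]

lemma meanField_zero (c β : ℝ) : meanField c β 0 = 0 := by simp [meanField]

lemma hasDerivAt_meanField (β : ℝ) (h1 : 0 < 1 + c * s) (h2 : 0 < 1 - s) :
    HasDerivAt (meanField c β) ((c + 1) / ((1 + c * s) * (1 - s)) - β) s := by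
  have hadd : HasDerivAt (fun s : ℝ => 1 + c * s) c s := by
    simpa using ((hasDerivAt_id s).const_mul c).const_add 1
  have hsub : HasDerivAt (fun s : ℝ => 1 - s) (-1) s := by
    simpa using (hasDerivAt_id s).const_sub 1
  have hmul : HasDerivAt (fun s : ℝ => β * s) β s := by
    simpa using (hasDerivAt_id s).const_mul β
  refine (((hadd.log h1.ne').sub (hsub.log h2.ne')).sub hmul).congr_deriv ?_
  have := h1.ne'
  have := h2.ne'
  field_simp
  ring

lemma deriv_meanField (hc : 0 ≤ c) (β : ℝ) (h0 : 0 ≤ s) (h1 : s < 1) :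
    deriv (meanField c β) s = (c + 1) / ((1 + c * s) * (1 - s)) - β :=
  (hasDerivAt_meanField β (by positivity) (by linarith)).deriv

lemma continuousOn_meanField (hc : 0 ≤ c) (β : ℝ) : ContinuousOn (meanField c β) (Ico 0 1) :=
  fun _ hs => (hasDerivAt_meanField β (by nlinarith [hs.1])
    (by linarith [hs.2])).continuousAt.continuousWithinAt

lemma strictAntiOn_deriv_meanField (hc : 1 ≤ c) (β : ℝ) :
    StrictAntiOn (deriv (meanField c β)) (Icc 0 (inflectionPoint c)) := by
  have hc0 : 0 < c := by linarith
  intro s hs t ht hst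
  have hs1 : s < 1 := hs.2.trans_lt (inflectionPoint_lt_one hc0)
  have ht1 : t < 1 := ht.2.trans_lt (inflectionPoint_lt_one hc0)
  rw [deriv_meanField hc0.le β hs.1 hs1, deriv_meanField hc0.le β ht.1 ht1]
  refine sub_lt_sub_right (div_lt_div_of_pos_left (by linarith) ?_
    (strictMonoOn_one_add_mul_one_sub hc0 hs.2 ht.2 hst)) _
  exact mul_pos (by nlinarith [hs.1]) (sub_pos.2 hs1)

lemma strictMonoOn_deriv_meanField (hc : 1 ≤ c) (β : ℝ) :
    StrictMonoOn (deriv (meanField c β)) (Ico (inflectionPoint c) 1) := by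
  have hc0 : 0 < c := by linarith
  intro s hs t ht hst
  have hs0 : 0 ≤ s := (inflectionPoint_nonneg hc).trans hs.1
  have ht0 : 0 ≤ t := (inflectionPoint_nonneg hc).trans ht.1
  rw [deriv_meanField hc0.le β hs0 hs.2, deriv_meanField hc0.le β ht0 ht.2]
  refine sub_lt_sub_right (div_lt_div_of_pos_left (by linarith) ?_
    (strictAntiOn_one_add_mul_one_sub hc0 hs.1 ht.1 hst)) _
  exact mul_pos (by positivity) (sub_pos.2 ht.2)

lemma strictConcaveOn_meanField (hc : 1 ≤ c) (β : ℝ) :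
    StrictConcaveOn ℝ (Icc 0 (inflectionPoint c)) (meanField c β) := by
  have hlt := inflectionPoint_lt_one (by linarith : 0 < c)
  exact ((strictAntiOn_deriv_meanField hc β).mono interior_subset).strictConcaveOn_of_deriv
    (convex_Icc _ _) ((continuousOn_meanField (by linarith) β).mono (Icc_subset_Ico_right hlt))

lemma strictConvexOn_meanField (hc : 1 ≤ c) (β : ℝ) :
    StrictConvexOn ℝ (Ico (inflectionPoint c) 1) (meanField c β) :=
  ((strictMonoOn_deriv_meanField hc β).mono interior_subset).strictConvexOn_of_deriv
    (convex_Ico _ _) ((continuousOn_meanField (by linarith) β).mono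
      (Ico_subset_Ico_left (inflectionPoint_nonneg hc)))

lemma meanField_pos_of_one_sub_exp_le (hc : 0 < c) (hβ : 0 < β) (hs : 0 < s) (hs1 : s < 1)
    (h : 1 - Real.exp (-β) ≤ s) : 0 < meanField c β s := by
  have hadd : 0 < Real.log (1 + c * s) := Real.log_pos (by nlinarith)
  have hsub : Real.log (1 - s) ≤ -β := by
    rw [Real.log_le_iff_le_exp (by linarith)]; linarith
  unfold meanField
  nlinarith

lemma exists_meanField_neg_right_of_eq_zero (hc : 1 ≤ c) (hs : 0 < s) (hst : s < t)
    (ht : t < 1) (hs0 : meanField c β s = 0) (ht0 : meanField c β t = 0) :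
    ∃ r, s < r ∧ r < 1 ∧ ∀ x ∈ Ioo s r, meanField c β x < 0 := by
  rcases lt_or_ge s (inflectionPoint c) with h | h
  · refine ⟨inflectionPoint c, h, inflectionPoint_lt_one (by linarith), fun x hx => ?_⟩
    have hslope := (strictConcaveOn_meanField hc β).slope_anti_adjacent (x := 0) (y := s) (z := x)
      ⟨le_rfl, inflectionPoint_nonneg hc⟩ ⟨hs.le.trans hx.1.le, hx.2.le⟩ hs hx.1
    rw [hs0, meanField_zero, sub_zero, sub_zero, zero_div] at hslope
    exact neg_of_div_neg_left hslope (sub_pos.2 hx.1).le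
  · refine ⟨t, hst, ht, fun x hx => ?_⟩
    have hlt := (strictConvexOn_meanField hc β).lt_on_openSegment (x := s) (y := t) (z := x)
      ⟨h, hst.trans ht⟩ ⟨h.trans hst.le, ht⟩ hst.ne (by rw [openSegment_eq_Ioo hst]; exact hx)
    rwa [hs0, ht0, max_self] at hlt

lemma meanField_nonneg_of_le_inflectionPoint (hc : 1 ≤ c) (hs : 0 ≤ s) (hst : s ≤ t)
    (ht : t ≤ inflectionPoint c) (h : 0 ≤ meanField c β t) : 0 ≤ meanField c β s := by
  have hmin := (strictConcaveOn_meanField hc β).concaveOn.min_le_of_mem_Icc (x := 0) (y := t)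
    (z := s) ⟨le_rfl, inflectionPoint_nonneg hc⟩ ⟨hs.trans hst, ht⟩ ⟨hs, hst⟩
  rwa [meanField_zero, min_eq_left h] at hmin

lemma meanField_nonpos_of_mem_Icc (hc : 1 ≤ c) (hs : 0 < s) (ht : t < 1)
    (hs0 : meanField c β s < 0) (ht0 : meanField c β t = 0) {x : ℝ} (hx : x ∈ Icc s t) :
    meanField c β x ≤ 0 := by
  have hconv : ∀ y, inflectionPoint c ≤ y → y ≤ x → meanField c β y ≤ 0 →
      meanField c β x ≤ 0 := by
    intro y hpy hyx hy
    have hmax := (strictConvexOn_meanField hc β).convexOn.le_max_of_mem_Icc (x := y) (y := t)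
      (z := x) ⟨hpy, by linarith [hx.2]⟩ ⟨by linarith [hx.2], ht⟩ ⟨hyx, hx.2⟩
    rwa [ht0, max_eq_right hy] at hmax
  have hconc : ∀ y, s ≤ y → y ≤ inflectionPoint c → meanField c β y ≤ 0 := by
    intro y hsy hy
    by_contra! hpos
    exact hs0.not_ge (meanField_nonneg_of_le_inflectionPoint hc hs.le hsy hy hpos.le)
  rcases le_total x (inflectionPoint c) with hxp | hpx
  · exact hconc x hx.1 hxp
  rcases le_total (inflectionPoint c) s with hps | hsp
  · exact hconv s hps hx.1 hs0.le
  · exact hconv _ le_rfl hpx (hconc _ hsp le_rfl)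

lemma strictAntiOn_meanField (hc : 1 ≤ c) (hβ : c + 1 ≤ β) :
    StrictAntiOn (meanField c β) (Icc 0 (inflectionPoint c)) := by
  have hlt := inflectionPoint_lt_one (by linarith : 0 < c)
  refine strictAntiOn_of_deriv_neg (convex_Icc _ _)
    ((continuousOn_meanField (by linarith) β).mono (Icc_subset_Ico_right hlt)) fun t ht => ?_
  rw [interior_Icc] at ht
  calc deriv (meanField c β) t < deriv (meanField c β) 0 :=
        strictAntiOn_deriv_meanField hc β ⟨le_rfl, inflectionPoint_nonneg hc⟩
          ⟨ht.1.le, ht.2.le⟩ ht.1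
    _ = c + 1 - β := by rw [deriv_meanField (by linarith) β le_rfl one_pos]; simp
    _ ≤ 0 := by linarith

lemma exists_meanField_neg_right_of_zero (hc : 1 ≤ c) (hβ : c + 1 ≤ β) (hs : 0 < s) (hs1 : s < 1)
    (h : meanField c β s < 0) : ∃ r, 0 < r ∧ r < 1 ∧ ∀ x ∈ Ioo 0 r, meanField c β x < 0 := by
  rcases (inflectionPoint_nonneg hc).eq_or_lt with hp | hp
  · refine ⟨s, hs, hs1, fun x hx => ?_⟩
    have hle := (strictConvexOn_meanField hc β).convexOn.secant_mono_aux1 (x := 0) (y := x) (z := s)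
      ⟨hp.ge, one_pos⟩ ⟨hp.symm.trans_le hs.le, hs1⟩ hx.1 hx.2
    rw [meanField_zero, mul_zero, zero_add] at hle
    exact neg_of_mul_neg_right (hle.trans_lt (mul_neg_of_pos_of_neg (by linarith [hx.1]) h))
      (by linarith)
  · refine ⟨_, hp, inflectionPoint_lt_one (by linarith), fun x hx => ?_⟩
    have hanti := strictAntiOn_meanField hc hβ ⟨le_rfl, hp.le⟩ ⟨hx.1.le, hx.2.le⟩ hx.1
    rwa [meanField_zero] at hanti

lemma exists_isGreatest_zero_meanField (hc : 1 ≤ c) (hβ : 0 < β) (hs : 0 < s) (hs1 : s < 1)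
    (h : meanField c β s < 0) :
    ∃ t, s < t ∧ t < 1 ∧ meanField c β t = 0 ∧ ∀ x ∈ Ioo t 1, 0 < meanField c β x := by
  set r := max ((s + 1) / 2) (1 - Real.exp (-β))
  have hsr : s < r := lt_of_lt_of_le (by linarith) (le_max_left _ _)
  have hr1 : r < 1 := max_lt (by linarith) (by linarith [Real.exp_pos (-β)])
  have hpos : ∀ x, r ≤ x → x < 1 → 0 < meanField c β x := fun x hx hx1 =>
    meanField_pos_of_one_sub_exp_le (by linarith) hβ (by linarith) hx1
      ((le_max_right _ _).trans hx)
  have hcont : ContinuousOn (meanField c β) (Icc s r) :=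
    (continuousOn_meanField (by linarith) β).mono fun x hx =>
      ⟨by linarith [hx.1], by linarith [hx.2]⟩
  have hcomp : IsCompact (Icc s r ∩ meanField c β ⁻¹' {0}) := isCompact_Icc.of_isClosed_subset
    (hcont.preimage_isClosed_of_isClosed isClosed_Icc isClosed_singleton) inter_subset_left
  have hzero : ∀ x ∈ Icc s r, meanField c β x ≤ 0 → ∃ y ∈ Icc x r, meanField c β y = 0 :=
    fun x hx hx0 => intermediate_value_Icc hx.2 (hcont.mono (Icc_subset_Icc_left hx.1))
      ⟨hx0, (hpos r le_rfl hr1).le⟩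
  obtain ⟨t, ht, htmax⟩ := hcomp.exists_isGreatest (hzero s ⟨le_rfl, hsr.le⟩ h.le)
  have ht0 : meanField c β t = 0 := ht.2
  refine ⟨t, lt_of_le_of_ne ht.1.1 fun hst => h.ne (hst ▸ ht0), by linarith [ht.1.2], ht0, ?_⟩
  intro x hx
  rcases le_or_gt r x with hxr | hxr
  · exact hpos x hxr hx.2
  by_contra! hneg
  obtain ⟨y, hy, hy0⟩ := hzero x ⟨by linarith [ht.1.1, hx.1], hxr.le⟩ hneg
  have : y ≤ t := htmax ⟨⟨by linarith [ht.1.1, hx.1, hy.1], hy.2⟩, hy0⟩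
  linarith [hx.1, hy.1]

end MeanField

section LocalMinimum

variable {q : ℕ} {β : ℝ} {x : Fin q → ℝ}

/-- `x` is a local minimum point of the free energy on the simplex. -/
def IsFreeEnergyMin (q : ℕ) (β : ℝ) (x : Fin q → ℝ) : Prop :=
  x ∈ stdSimplex ℝ (Fin q) ∧ IsLocalMinOn (freeEnergy q β) (stdSimplex ℝ (Fin q)) x

/-- The result of moving mass `t` from coordinate `b` to coordinate `a`. -/
def transfer (x : Fin q → ℝ) (a b : Fin q) (t : ℝ) : Fin q → ℝ := fun k =>
  if k = a then x a + t else if k = b then x b - t else x k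

lemma sum_transfer (x : Fin q → ℝ) {a b : Fin q} (hab : a ≠ b) (t : ℝ) (f : ℝ → ℝ) :
    ∑ k, f (transfer x a b t k) =
      ∑ k, f (x k) + (f (x a + t) - f (x a)) + (f (x b - t) - f (x b)) := by
  have h : ∑ k, (f (transfer x a b t k) - f (x k)) =
      (f (x a + t) - f (x a)) + (f (x b - t) - f (x b)) := by
    rw [← Finset.sum_subset (Finset.subset_univ {a, b}), Finset.sum_pair hab]
    · simp [transfer, hab.symm]
    · intro k _ hk
      simp only [Finset.mem_insert, Finset.mem_singleton, not_or] at hk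
      simp [transfer, hk.1, hk.2]
  rw [Finset.sum_sub_distrib] at h
  linarith

lemma transfer_mem_stdSimplex (hx : x ∈ stdSimplex ℝ (Fin q)) {a b : Fin q} (hab : a ≠ b) {t : ℝ}
    (ha : 0 ≤ x a + t) (hb : 0 ≤ x b - t) : transfer x a b t ∈ stdSimplex ℝ (Fin q) := by
  refine ⟨fun k => ?_, ?_⟩
  · unfold transfer
    split_ifs
    exacts [ha, hb, hx.1 k]
  · rw [sum_transfer x hab t fun y => y, hx.2]; ring

lemma tendsto_transfer (x : Fin q → ℝ) (a b : Fin q) :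
    Tendsto (transfer x a b) (𝓝 0) (𝓝 x) := by
  have hcont : Continuous (transfer x a b) := continuous_pi fun k => by
    unfold transfer
    split_ifs <;> fun_prop
  have hzero : transfer x a b 0 = x := by
    funext k
    unfold transfer
    split_ifs <;> simp_all
  simpa only [hzero] using hcont.tendsto 0

lemma IsFreeEnergyMin.eventually_siteEnergy_le (h : IsFreeEnergyMin q β x) (hβ : 0 < β)
    {a b : Fin q} (hab : a ≠ b) :
    ∀ᶠ t in 𝓝 0, 0 ≤ x a + t → 0 ≤ x b - t →
      siteEnergy β (x a) + siteEnergy β (x b) ≤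
        siteEnergy β (x a + t) + siteEnergy β (x b - t) := by
  filter_upwards [(tendsto_transfer x a b).eventually (eventually_nhdsWithin_iff.1 h.2)]
    with t ht ha hb
  have hle := ht (transfer_mem_stdSimplex h.1 hab ha hb)
  rw [freeEnergy_eq q hβ, freeEnergy_eq q hβ, sum_transfer x hab] at hle
  linarith [le_of_mul_le_mul_left hle (by positivity : 0 < 1 / β)]

lemma siteEnergy_add_siteEnergy_sub_lt (hβ : 0 < β) {t y : ℝ} (ht : 0 < t) (hty : t < y)
    (hlt : t < y * Real.exp (-(β * y))) :
    siteEnergy β t + siteEnergy β (y - t) < siteEnergy β y := by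
  have hy : 0 < y := ht.trans hty
  have hlog : Real.log t < Real.log y - β * y := by
    have := Real.log_lt_log ht hlt
    rwa [Real.log_mul hy.ne' (Real.exp_pos _).ne', Real.log_exp, ← sub_eq_add_neg] at this
  have hsub : (y - t) * Real.log (y - t) ≤ (y - t) * Real.log y :=
    mul_le_mul_of_nonneg_left (Real.log_le_log (by linarith) (by linarith)) (by linarith)
  have hmul : t * Real.log t < t * (Real.log y - β * y) := mul_lt_mul_of_pos_left hlog ht
  unfold siteEnergy
  nlinarith [mul_pos hβ (mul_pos ht ht)]

/-- The slope of `t * log t` at `0` is `-∞`, so a vanishing coordinate gains from any other. -/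
lemma IsFreeEnergyMin.pos (h : IsFreeEnergyMin q β x) (hβ : 0 < β) (a : Fin q) : 0 < x a := by
  refine (h.1.1 a).lt_of_ne' fun ha => ?_
  obtain ⟨b, -, hxb⟩ : ∃ b ∈ Finset.univ, x b ≠ 0 :=
    Finset.exists_ne_zero_of_sum_ne_zero (h.1.2.trans_ne one_ne_zero)
  have hb : 0 < x b := (h.1.1 b).lt_of_ne' hxb
  have hab : a ≠ b := by rintro rfl; exact hb.ne' ha
  have hsmall : ∀ᶠ t in 𝓝 0, t < min (x b) (x b * Real.exp (-(β * x b))) :=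
    gt_mem_nhds (by positivity)
  obtain ⟨t, ⟨hle, hlt⟩, ht⟩ := ((h.eventually_siteEnergy_le hβ hab).and hsmall
    |>.filter_mono nhdsWithin_le_nhds |>.and (self_mem_nhdsWithin (s := Ioi 0))).exists
  rw [lt_min_iff] at hlt
  have ht : 0 < t := ht
  have hle := hle (by linarith) (by linarith)
  rw [ha, zero_add, siteEnergy, zero_mul] at hle
  linarith [siteEnergy_add_siteEnergy_sub_lt hβ ht hlt.1 hlt.2]

lemma IsFreeEnergyMin.log_sub_mul_eq (h : IsFreeEnergyMin q β x) (hβ : 0 < β) (a b : Fin q) :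
    Real.log (x a) - β * x a = Real.log (x b) - β * x b := by
  rcases eq_or_ne a b with rfl | hab
  · rfl
  have ha := h.pos hβ a
  have hb := h.pos hβ b
  have hmin : IsLocalMin (fun t => siteEnergy β (x a + t) + siteEnergy β (x b - t)) 0 := by
    filter_upwards [h.eventually_siteEnergy_le hβ hab, lt_mem_nhds (neg_lt_zero.2 ha),
      gt_mem_nhds hb] with t ht hta htb
    simpa only [add_zero, sub_zero] using ht (by linarith) (by linarith)
  have hderiv : HasDerivAt (fun t => siteEnergy β (x a + t) + siteEnergy β (x b - t))
      ((Real.log (x a) - β * x a + 1) - (Real.log (x b) - β * x b + 1)) 0 := by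
    have hga : HasDerivAt (siteEnergy β) (Real.log (x a) - β * x a + 1) (x a + 0) := by
      rw [add_zero]; exact hasDerivAt_siteEnergy β ha
    have hgb : HasDerivAt (siteEnergy β) (Real.log (x b) - β * x b + 1) (x b - 0) := by
      rw [sub_zero]; exact hasDerivAt_siteEnergy β hb
    exact (hga.comp_const_add (x a) 0).add (hgb.comp_const_sub (x b) 0)
  linarith [hmin.hasDerivAt_eq_zero hderiv]

/-- Beyond the inflection point `1 / β` strict concavity would favour separating equal
coordinates. -/
lemma IsFreeEnergyMin.le_of_eq (h : IsFreeEnergyMin q β x) (hβ : 0 < β) {a b : Fin q}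
    (hab : a ≠ b) (heq : x a = x b) : x a ≤ 1 / β := by
  by_contra! hlt
  obtain ⟨t, ⟨hle, ht⟩, htpos⟩ := ((h.eventually_siteEnergy_le hβ hab).and
    (gt_mem_nhds (sub_pos.2 hlt)) |>.filter_mono nhdsWithin_le_nhds
    |>.and (self_mem_nhdsWithin (s := Ioi 0))).exists
  have : 0 < t := htpos
  have hβ' : 0 < 1 / β := by positivity
  have hle := hle (by linarith) (by linarith)
  have hconc := @(strictConcaveOn_siteEnergy hβ).2 (x a + t) (mem_Ici.2 (by linarith)) (x a - t)
    (mem_Ici.2 (by linarith)) (by linarith) (1 / 2) (1 / 2) (by norm_num) (by norm_num)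
    (by norm_num)
  simp only [smul_eq_mul] at hconc
  rw [show 1 / 2 * (x a + t) + 1 / 2 * (x a - t) = x a by ring] at hconc
  rw [← heq] at hle
  linarith

lemma exists_lt_of_ne_barycentre (hx : x ∈ stdSimplex ℝ (Fin q)) (hne : x ≠ barycentre q) :
    ∃ i j, x j < x i := by
  by_contra! hall
  refine hne (funext fun k => ?_)
  have hsum : ∑ l, x l = ∑ _ : Fin q, x k :=
    Finset.sum_congr rfl fun l _ => le_antisymm (hall l k) (hall k l)
  rw [hx.2, Finset.sum_const, Finset.card_fin, nsmul_eq_mul] at hsum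
  exact eq_one_div_of_mul_eq_one_right hsum.symm

lemma IsFreeEnergyMin.eq_of_lt (h : IsFreeEnergyMin q β x) (hβ : 0 < β) {i j k : Fin q}
    (hij : x j < x i) (hk : k ≠ i) : x k = x j := by
  have hcrit := h.log_sub_mul_eq hβ
  obtain ⟨hj, hi⟩ := lt_and_lt_of_log_sub_mul_eq hβ (h.pos hβ j) hij (hcrit j i)
  have hk' : x k < 1 / β := by
    rcases lt_trichotomy (x k) (x i) with hlt | heq | hgt
    · exact (lt_and_lt_of_log_sub_mul_eq hβ (h.pos hβ k) hlt (hcrit k i)).1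
    · exact absurd (h.le_of_eq hβ hk heq) (by linarith)
    · exact absurd (lt_and_lt_of_log_sub_mul_eq hβ (h.pos hβ i) hgt (hcrit i k)).1 hi.not_gt
  exact (strictMonoOn_log_sub_mul hβ).injOn ⟨h.pos hβ k, hk'.le⟩ ⟨h.pos hβ j, hj.le⟩ (hcrit k j)

end LocalMinimum

section Ray

variable {q : ℕ} {β : ℝ} (i : Fin q)

/-- The ray from the barycentre (`s = 0`) through the vertex `i` of the simplex (`s = 1`). -/
noncomputable def ray (q : ℕ) (i : Fin q) (s : ℝ) : Fin q → ℝ := fun k =>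
  if k = i then (1 + ((q : ℝ) - 1) * s) / q else (1 - s) / q

lemma sum_ray (s : ℝ) (f : ℝ → ℝ) :
    ∑ k, f (ray q i s k) =
      f ((1 + ((q : ℝ) - 1) * s) / q) + ((q : ℝ) - 1) * f ((1 - s) / q) := by
  have hq : 1 ≤ q := Nat.one_le_of_lt i.2
  have herase : ∀ k ∈ Finset.univ.erase i, f (ray q i s k) = f ((1 - s) / q) := fun k hk => by
    rw [ray, if_neg (Finset.ne_of_mem_erase hk)]
  rw [← Finset.add_sum_erase _ _ (Finset.mem_univ i), Finset.sum_congr rfl herase]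
  simp [ray, Finset.card_erase_of_mem, Nat.cast_sub hq]

lemma one_le_natCast_of_fin {q : ℕ} (i : Fin q) : (1 : ℝ) ≤ q := by
  exact_mod_cast Nat.one_le_of_lt i.2

lemma ray_mem_stdSimplex {s : ℝ} (h0 : 0 ≤ s) (h1 : s ≤ 1) : ray q i s ∈ stdSimplex ℝ (Fin q) := by
  have hq := one_le_natCast_of_fin i
  refine ⟨fun k => ?_, ?_⟩
  · unfold ray
    split_ifs
    · exact div_nonneg (by nlinarith) (by linarith)
    · exact div_nonneg (by linarith) (by linarith)
  · rw [sum_ray i s fun y => y]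
    field_simp
    ring

lemma ray_zero : ray q i 0 = barycentre q := by
  funext k; simp [ray, barycentre]

lemma continuous_ray : Continuous (ray q i) := continuous_pi fun k => by
  unfold ray
  split_ifs <;> fun_prop

variable {i}

lemma eq_ray_of_forall_ne {x : Fin q → ℝ} {u : ℝ} (hx : x ∈ stdSimplex ℝ (Fin q))
    (h : ∀ k ≠ i, x k = u) : x = ray q i (1 - q * u) := by
  have hq := one_le_natCast_of_fin i
  have hsum : x i + ((q : ℝ) - 1) * u = 1 := by
    have hmass := hx.2
    rw [← Finset.add_sum_erase _ _ (Finset.mem_univ i),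
      Finset.sum_congr rfl fun k hk => h k (Finset.ne_of_mem_erase hk)] at hmass
    simpa [Finset.card_erase_of_mem, Nat.cast_sub (Nat.one_le_of_lt i.2)] using hmass
  funext k
  unfold ray
  split_ifs with hk
  · rw [hk, eq_div_iff (by linarith)]; linear_combination (q : ℝ) * hsum
  · rw [h k hk]; field_simp; ring

/-- The mean-field function is the criticality condition of the free energy along a ray. -/
lemma meanField_eq_log_sub_mul (hq : 0 < q) {s : ℝ} (h0 : 0 < 1 + ((q : ℝ) - 1) * s)
    (h1 : 0 < 1 - s) :
    meanField ((q : ℝ) - 1) β s =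
      (Real.log ((1 + ((q : ℝ) - 1) * s) / q) - β * ((1 + ((q : ℝ) - 1) * s) / q)) -
        (Real.log ((1 - s) / q) - β * ((1 - s) / q)) := by
  have hq0 : (q : ℝ) ≠ 0 := by positivity
  rw [Real.log_div h0.ne' hq0, Real.log_div h1.ne' hq0, meanField]
  field_simp
  ring

lemma IsFreeEnergyMin.exists_eq_ray {x : Fin q → ℝ} (h : IsFreeEnergyMin q β x) (hβ : 0 < β)
    (hne : x ≠ barycentre q) :
    ∃ i s, 0 < s ∧ s < 1 ∧ x = ray q i s ∧ meanField ((q : ℝ) - 1) β s = 0 := by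
  obtain ⟨i, j, hij⟩ := exists_lt_of_ne_barycentre h.1 hne
  have hq : (0 : ℝ) < q := by linarith [one_le_natCast_of_fin i]
  have hji : j ≠ i := by rintro rfl; exact hij.false
  set s := 1 - q * x j
  have hray : x = ray q i s := eq_ray_of_forall_ne h.1 fun k hk => h.eq_of_lt hβ hij hk
  have hxi : (1 + ((q : ℝ) - 1) * s) / q = x i := by
    conv_rhs => rw [hray]
    simp [ray]
  have hxj : (1 - s) / q = x j := by
    conv_rhs => rw [hray]
    simp [ray, hji]
  have hi : 0 < 1 + ((q : ℝ) - 1) * s := (div_pos_iff_of_pos_right hq).1 (hxi ▸ h.pos hβ i)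
  have hj : 0 < 1 - s := (div_pos_iff_of_pos_right hq).1 (hxj ▸ h.pos hβ j)
  rw [← hxi, ← hxj, div_lt_div_iff_of_pos_right hq] at hij
  refine ⟨i, s, by nlinarith, by linarith, hray, ?_⟩
  rw [meanField_eq_log_sub_mul (by exact_mod_cast hq) hi hj, hxi, hxj, h.log_sub_mul_eq hβ i j,
    sub_self]

lemma hasDerivAt_freeEnergy_ray (hβ : 0 < β) (i : Fin q) {s : ℝ} (h0 : 0 ≤ s) (h1 : s < 1) :
    HasDerivAt (fun s => freeEnergy q β (ray q i s))
      (((q : ℝ) - 1) / (β * q) * meanField ((q : ℝ) - 1) β s) s := by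
  have hq := one_le_natCast_of_fin i
  have hq0 : (0 : ℝ) < q := by linarith
  have hadd : 0 < 1 + ((q : ℝ) - 1) * s := by nlinarith
  have hsub : 0 < 1 - s := by linarith
  simp only [freeEnergy_eq q hβ, sum_ray]
  have hda : HasDerivAt (fun s : ℝ => (1 + ((q : ℝ) - 1) * s) / q) (((q : ℝ) - 1) / q) s := by
    simpa using (((hasDerivAt_id s).const_mul ((q : ℝ) - 1)).const_add 1).div_const (q : ℝ)
  have hds : HasDerivAt (fun s : ℝ => (1 - s) / q) (-1 / q) s := by
    simpa using ((hasDerivAt_id s).const_sub 1).div_const (q : ℝ)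
  have hga := (hasDerivAt_siteEnergy β (div_pos hadd hq0)).comp s hda
  have hgs := (hasDerivAt_siteEnergy β (div_pos hsub hq0)).comp s hds
  refine ((hga.add (hgs.const_mul ((q : ℝ) - 1))).const_mul (1 / β)).congr_deriv ?_
  rw [meanField_eq_log_sub_mul (by exact_mod_cast hq0) hadd hsub]
  field_simp
  ring

lemma not_isFreeEnergyMin_ray (hq : 2 ≤ q) (hβ : 0 < β) {s r : ℝ} (h0 : 0 ≤ s) (hsr : s < r)
    (hr : r < 1) (hneg : ∀ x ∈ Ioo s r, meanField ((q : ℝ) - 1) β x < 0) :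
    ¬ IsFreeEnergyMin q β (ray q i s) := by
  intro h
  have hq' : (2 : ℝ) ≤ q := by exact_mod_cast hq
  have hanti : StrictAntiOn (fun s => freeEnergy q β (ray q i s)) (Icc s r) := by
    refine strictAntiOn_of_deriv_neg (convex_Icc _ _) (fun t ht =>
      (hasDerivAt_freeEnergy_ray hβ i (h0.trans ht.1)
        (ht.2.trans_lt hr)).continuousAt.continuousWithinAt) fun t ht => ?_
    rw [interior_Icc] at ht
    rw [(hasDerivAt_freeEnergy_ray hβ i (h0.trans ht.1.le) (ht.2.trans hr)).deriv]
    exact mul_neg_of_pos_of_neg (div_pos (by linarith) (by positivity)) (hneg t ht)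
  have hmin : ∀ᶠ t in 𝓝 s, ray q i t ∈ stdSimplex ℝ (Fin q) →
      freeEnergy q β (ray q i s) ≤ freeEnergy q β (ray q i t) :=
    (continuous_ray i).continuousAt.eventually (eventually_nhdsWithin_iff.1 h.2)
  obtain ⟨t, hle, ht⟩ :=
    (hmin.filter_mono nhdsWithin_le_nhds |>.and (Ioo_mem_nhdsGT hsr)).exists
  exact (hle (ray_mem_stdSimplex i (h0.trans ht.1.le) (ht.2.trans hr).le)).not_gt
    (hanti ⟨le_rfl, hsr.le⟩ ⟨ht.1.le, ht.2.le⟩ ht.1)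

end Ray

section OrderParameter

variable {q : ℕ} {β : ℝ}

lemma one_le_natCast_sub_one (hq : 2 ≤ q) : (1 : ℝ) ≤ (q : ℝ) - 1 := by
  have : (2 : ℝ) ≤ q := by exact_mod_cast hq
  linarith

lemma orderParameter_eq (hq : 2 ≤ q) {t : ℝ} (h0 : 0 < t) (h1 : t < 1)
    (ht : meanField ((q : ℝ) - 1) β t = 0)
    (hmax : ∀ x ∈ Ioo t 1, meanField ((q : ℝ) - 1) β x ≠ 0) : orderParameter q β = t := by
  have _ := one_le_natCast_sub_one hq
  refine IsGreatest.csSup_eq ⟨⟨by nlinarith, by linarith, sub_eq_zero.1 ht⟩, fun s hs => ?_⟩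
  by_contra! hlt
  exact hmax s ⟨hlt, by linarith [hs.2.1]⟩ (sub_eq_zero.2 hs.2.2)

lemma freeEnergy_barycentre (hq : 0 < q) (β : ℝ) :
    freeEnergy q β (barycentre q) = -(1 / (2 * q)) - Real.log q / β := by
  have hq0 : (q : ℝ) ≠ 0 := by positivity
  simp only [freeEnergy, barycentre, Finset.sum_const, Finset.card_fin, nsmul_eq_mul,
    Real.log_div one_ne_zero hq0, Real.log_one]
  field_simp
  ring

lemma freeEnergy_ray_one (i : Fin q) (β : ℝ) : freeEnergy q β (ray q i 1) = -(1 / 2) := by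
  have hq0 : (q : ℝ) ≠ 0 := by linarith [one_le_natCast_of_fin i]
  rw [freeEnergy, sum_ray i 1 (· ^ 2), sum_ray i 1 fun t => t * Real.log t]
  simp [hq0]

/-- For large `β` the energy beats the entropy, so the barycentre is not a global minimiser. -/
lemma exists_isFreeEnergyMin_ne_barycentre (hq : 2 ≤ q) :
    ∃ β : ℝ, 0 < β ∧ ∃ x, IsFreeEnergyMin q β x ∧ x ≠ barycentre q := by
  have hq' : (2 : ℝ) ≤ q := by exact_mod_cast hq
  have hlog : 0 < Real.log q := Real.log_pos (by linarith)
  let i : Fin q := ⟨0, by lia⟩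
  have hvertex : ray q i 1 ∈ stdSimplex ℝ (Fin q) := ray_mem_stdSimplex i zero_le_one le_rfl
  obtain ⟨x, hx, hmin⟩ := (isCompact_stdSimplex ℝ (Fin q)).exists_isMinOn ⟨_, hvertex⟩
    (continuous_freeEnergy q (8 * Real.log q)).continuousOn
  refine ⟨8 * Real.log q, by positivity, x, ⟨hx, hmin.localize⟩, ?_⟩
  rintro rfl
  have hle := isMinOn_iff.1 hmin _ hvertex
  rw [freeEnergy_ray_one, freeEnergy_barycentre (by lia)] at hle
  have hentropy : Real.log q / (8 * Real.log q) = 1 / 8 := by field_simp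
  have henergy : 1 / (2 * (q : ℝ)) ≤ 1 / 4 :=
    one_div_le_one_div_of_le (by norm_num) (by linarith)
  linarith

lemma exists_lt_isFreeEnergyMin (hq : 2 ≤ q) (hβ : betaOne q < β) :
    ∃ β', 0 < β' ∧ β' < β ∧ ∃ x, IsFreeEnergyMin q β' x ∧ x ≠ barycentre q := by
  obtain ⟨β₀, hβ₀, y, hy, hyne⟩ := exists_isFreeEnergyMin_ne_barycentre hq
  unfold betaOne at hβ
  obtain ⟨β', ⟨hβ', x, hx, hne, hmin⟩, hlt⟩ :=
    exists_lt_of_csInf_lt (by exact ⟨β₀, hβ₀, y, hy.1, hyne, hy.2⟩) hβ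
  exact ⟨β', hβ', hlt, x, ⟨hx, hmin⟩, hne⟩

lemma pos_of_betaOne_lt (hq : 2 ≤ q) (hβ : betaOne q < β) : 0 < β := by
  obtain ⟨β', hβ', hlt, -⟩ := exists_lt_isFreeEnergyMin hq hβ
  exact hβ'.trans hlt

/-- A zero of the mean-field function at some `β' < β` is a point of negativity at `β`. -/
lemma exists_meanField_neg (hq : 2 ≤ q) (hβ : betaOne q < β) :
    ∃ s, 0 < s ∧ s < 1 ∧ meanField ((q : ℝ) - 1) β s < 0 := by
  obtain ⟨β', hβ', hlt, x, hx, hne⟩ := exists_lt_isFreeEnergyMin hq hβ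
  obtain ⟨i, s, hs0, hs1, -, hs⟩ := hx.exists_eq_ray hβ' hne
  refine ⟨s, hs0, hs1, ?_⟩
  unfold meanField at hs ⊢
  nlinarith

lemma exists_meanField_neg_lt_orderParameter (hq : 2 ≤ q) (hβ : betaOne q < β) :
    ∃ s, 0 < s ∧ s < orderParameter q β ∧ orderParameter q β < 1 ∧
      meanField ((q : ℝ) - 1) β s < 0 ∧
      meanField ((q : ℝ) - 1) β (orderParameter q β) = 0 ∧
      ∀ x ∈ Ioo (orderParameter q β) 1, 0 < meanField ((q : ℝ) - 1) β x := by
  obtain ⟨s, hs0, hs1, hneg⟩ := exists_meanField_neg hq hβ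
  obtain ⟨t, hst, ht1, ht, hpos⟩ := exists_isGreatest_zero_meanField (one_le_natCast_sub_one hq)
    (pos_of_betaOne_lt hq hβ) hs0 hs1 hneg
  rw [orderParameter_eq hq (hs0.trans hst) ht1 ht fun x hx => (hpos x hx).ne']
  exact ⟨s, hs0, hst, ht1, hneg, ht, hpos⟩

lemma orderParameter_mem_Ioo (hq : 2 ≤ q) (hβ : betaOne q < β) : orderParameter q β ∈ Ioo 0 1 := by
  obtain ⟨s, hs0, hst, ht1, -⟩ := exists_meanField_neg_lt_orderParameter hq hβ
  exact ⟨hs0.trans hst, ht1⟩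

lemma meanField_orderParameter (hq : 2 ≤ q) (hβ : betaOne q < β) :
    meanField ((q : ℝ) - 1) β (orderParameter q β) = 0 := by
  obtain ⟨s, -, -, -, -, ht, -⟩ := exists_meanField_neg_lt_orderParameter hq hβ
  exact ht

lemma one_sub_orderParameter_div_lt (hq : 2 ≤ q) (hβ : betaOne q < β) :
    (1 - orderParameter q β) / q < 1 / β := by
  obtain ⟨ht0, ht1⟩ := orderParameter_mem_Ioo hq hβ
  have hc := one_le_natCast_sub_one hq
  have hq0 : (0 : ℝ) < q := by linarith
  have hadd : 0 < 1 + ((q : ℝ) - 1) * orderParameter q β := by positivity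
  have hmf := meanField_orderParameter hq hβ
  rw [meanField_eq_log_sub_mul (by lia) hadd (by linarith), sub_eq_zero] at hmf
  exact (lt_and_lt_of_log_sub_mul_eq (pos_of_betaOne_lt hq hβ) (div_pos (by linarith) hq0)
    (div_lt_div_of_pos_right (by nlinarith) hq0) hmf.symm).1

end OrderParameter

section Jensen

variable {q : ℕ} {β : ℝ} {y : Fin q → ℝ}

lemma card_mul_siteEnergy_le {ι : Type*} {t : Finset ι} (ht : t.Nonempty) (hβ : 0 < β)
    {x : ι → ℝ} (hx : ∀ k ∈ t, x k ∈ Icc 0 (1 / β)) :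
    t.card * siteEnergy β ((∑ k ∈ t, x k) / t.card) ≤ ∑ k ∈ t, siteEnergy β (x k) := by
  have hc : (0 : ℝ) < t.card := by exact_mod_cast ht.card_pos
  have h := (strictConvexOn_siteEnergy hβ).convexOn.map_sum_le (t := t)
    (w := fun _ => 1 / (t.card : ℝ)) (p := x) (fun _ _ => by positivity)
    (by rw [Finset.sum_const, nsmul_eq_mul]; field_simp) hx
  simp only [smul_eq_mul, ← Finset.mul_sum] at h
  rw [div_eq_inv_mul, ← one_div]
  calc t.card * siteEnergy β (1 / (t.card : ℝ) * ∑ k ∈ t, x k)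
      ≤ t.card * (1 / (t.card : ℝ) * ∑ k ∈ t, siteEnergy β (x k)) :=
        mul_le_mul_of_nonneg_left h hc.le
    _ = _ := by field_simp

lemma freeEnergy_barycentre_le (hβ : 0 < β) (hy : y ∈ stdSimplex ℝ (Fin q))
    (hle : ∀ k, y k ≤ 1 / β) : freeEnergy q β (barycentre q) ≤ freeEnergy q β y := by
  have hne : (Finset.univ : Finset (Fin q)).Nonempty :=
    Finset.nonempty_of_sum_ne_zero (hy.2.trans_ne one_ne_zero)
  have h := card_mul_siteEnergy_le hne hβ fun k _ => ⟨hy.1 k, hle k⟩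
  rw [hy.2, Finset.card_fin] at h
  rw [freeEnergy_eq q hβ, freeEnergy_eq q hβ]
  exact mul_le_mul_of_nonneg_left (by simpa [barycentre] using h) (by positivity)

lemma freeEnergy_ray_le (hq : 2 ≤ q) (hβ : 0 < β) (i : Fin q)
    (hy : y ∈ stdSimplex ℝ (Fin q)) (hle : ∀ k ≠ i, y k ≤ 1 / β) :
    freeEnergy q β (ray q i ((q * y i - 1) / ((q : ℝ) - 1))) ≤ freeEnergy q β y := by
  have hc := one_le_natCast_sub_one hq
  have hq0 : (q : ℝ) ≠ 0 := by linarith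
  have hq1 : (q : ℝ) - 1 ≠ 0 := by linarith
  have hcard : (Finset.univ.erase i).card = q - 1 := by simp [Finset.card_erase_of_mem]
  have hne : (Finset.univ.erase i).Nonempty := by rw [← Finset.card_pos]; lia
  have hsum : ∑ k ∈ Finset.univ.erase i, y k = 1 - y i := by
    rw [← hy.2, ← Finset.add_sum_erase Finset.univ y (Finset.mem_univ i), add_sub_cancel_left]
  have hjensen := card_mul_siteEnergy_le hne hβ (x := y)
    fun k hk => ⟨hy.1 k, hle k (Finset.ne_of_mem_erase hk)⟩
  rw [hcard, hsum, Nat.cast_pred (by lia)] at hjensen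
  have hyi : (1 + ((q : ℝ) - 1) * ((q * y i - 1) / ((q : ℝ) - 1))) / q = y i := by
    field_simp; ring
  have hyk : (1 - (q * y i - 1) / ((q : ℝ) - 1)) / q = (1 - y i) / ((q : ℝ) - 1) := by
    field_simp; ring
  rw [freeEnergy_eq q hβ, freeEnergy_eq q hβ, sum_ray, hyi, hyk,
    ← Finset.add_sum_erase _ _ (Finset.mem_univ i)]
  exact mul_le_mul_of_nonneg_left (by linarith) (by positivity)

end Jensen

section Minima

variable {q : ℕ} {β : ℝ}

lemma isFreeEnergyMin_barycentre (hq : 0 < q) (hβ : 0 < β) (hβq : β < q) :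
    IsFreeEnergyMin q β (barycentre q) := by
  have hnear : ∀ᶠ y in 𝓝 (barycentre q), ∀ k, y k < 1 / β := eventually_all.2 fun k =>
    (continuous_apply k).continuousAt.eventually_lt_const (one_div_lt_one_div_of_lt hβ hβq)
  refine ⟨?_, eventually_nhdsWithin_iff.2 ?_⟩
  · rw [← ray_zero ⟨0, hq⟩]; exact ray_mem_stdSimplex _ le_rfl zero_le_one
  · filter_upwards [hnear] with y hy hmem
    exact freeEnergy_barycentre_le hβ hmem fun k => (hy k).le

lemma isLocalMin_freeEnergy_ray_orderParameter (hq : 2 ≤ q) (hβ : betaOne q < β) (i : Fin q) :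
    IsLocalMin (fun s => freeEnergy q β (ray q i s)) (orderParameter q β) := by
  have hc := one_le_natCast_sub_one hq
  have hβ0 := pos_of_betaOne_lt hq hβ
  obtain ⟨s, hs0, hst, ht1, hneg, hzero, hpos⟩ := exists_meanField_neg_lt_orderParameter hq hβ
  have hcoef : 0 ≤ ((q : ℝ) - 1) / (β * q) := div_nonneg (by linarith) (by positivity)
  have hderiv : ∀ x ∈ Ioo s 1, HasDerivAt (fun s => freeEnergy q β (ray q i s))
      (((q : ℝ) - 1) / (β * q) * meanField ((q : ℝ) - 1) β x) x := fun x hx =>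
    hasDerivAt_freeEnergy_ray hβ0 i (hs0.trans hx.1).le hx.2
  have hleft : ∀ x ∈ Ioo s (orderParameter q β), x ∈ Ioo s 1 := fun x hx => ⟨hx.1, hx.2.trans ht1⟩
  have hright : ∀ x ∈ Ioo (orderParameter q β) 1, x ∈ Ioo s 1 := fun x hx => ⟨hst.trans hx.1, hx.2⟩
  refine isLocalMin_of_deriv_Ioo hst ht1 (hderiv _ ⟨hst, ht1⟩).continuousAt
    (fun x hx => (hderiv x (hleft x hx)).differentiableAt.differentiableWithinAt)
    (fun x hx => (hderiv x (hright x hx)).differentiableAt.differentiableWithinAt)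
    (fun x hx => ?_) fun x hx => ?_
  · rw [(hderiv x (hleft x hx)).deriv]
    exact mul_nonpos_of_nonneg_of_nonpos hcoef
      (meanField_nonpos_of_mem_Icc hc hs0 ht1 hneg hzero (Ioo_subset_Icc_self hx))
  · rw [(hderiv x (hright x hx)).deriv]
    exact mul_nonneg hcoef (hpos x hx).le

lemma isFreeEnergyMin_ray_orderParameter (hq : 2 ≤ q) (hβ : betaOne q < β) (i : Fin q) :
    IsFreeEnergyMin q β (ray q i (orderParameter q β)) := by
  have hc := one_le_natCast_sub_one hq
  set t := orderParameter q β
  obtain ⟨ht0, ht1⟩ := orderParameter_mem_Ioo hq hβ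
  refine ⟨ray_mem_stdSimplex i ht0.le ht1.le, eventually_nhdsWithin_iff.2 ?_⟩
  have hsmall : ∀ᶠ y in 𝓝 (ray q i t), ∀ k, k ≠ i → y k < 1 / β :=
    eventually_all.2 fun k => eventually_imp_distrib_left.2 fun hk =>
      (continuous_apply k).continuousAt.eventually_lt_const <| by
        simpa only [ray, if_neg hk] using one_sub_orderParameter_div_lt hq hβ
  have hparam : Tendsto (fun y : Fin q → ℝ => (q * y i - 1) / ((q : ℝ) - 1))
      (𝓝 (ray q i t)) (𝓝 t) := by
    have hcont : Continuous fun y : Fin q → ℝ => (q * y i - 1) / ((q : ℝ) - 1) := by fun_prop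
    have hval : (q * ray q i t i - 1) / ((q : ℝ) - 1) = t := by
      rw [ray, if_pos rfl, mul_div_cancel₀ _ (by linarith), add_sub_cancel_left,
        mul_div_cancel_left₀ _ (by linarith)]
    simpa only [hval] using hcont.tendsto (ray q i t)
  filter_upwards [hsmall, hparam.eventually (isLocalMin_freeEnergy_ray_orderParameter hq hβ i)]
    with y hy hray hmem
  exact hray.trans
    (freeEnergy_ray_le hq (pos_of_betaOne_lt hq hβ) i hmem fun k hk => (hy k hk).le)

lemma none_mem_indexSet_iff : none ∈ indexSet q β ↔ β < q := by
  unfold indexSet; split_ifs with h <;> simp [h]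

lemma some_mem_indexSet (i : Fin q) : some i ∈ indexSet q β := by
  unfold indexSet; split_ifs <;> simp

lemma minimum_some (q : ℕ) (β : ℝ) (i : Fin q) :
    minimum q β (some i) = ray q i (orderParameter q β) := rfl

lemma not_isFreeEnergyMin_barycentre (hq : 2 ≤ q) (hβ : betaOne q < β) (hβq : q ≤ β) :
    ¬ IsFreeEnergyMin q β (barycentre q) := by
  obtain ⟨s, hs0, hs1, hneg⟩ := exists_meanField_neg hq hβ
  obtain ⟨r, hr0, hr1, hr⟩ := exists_meanField_neg_right_of_zero (one_le_natCast_sub_one hq)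
    (by linarith : (q : ℝ) - 1 + 1 ≤ β) hs0 hs1 hneg
  rw [← ray_zero ⟨0, by lia⟩]
  exact not_isFreeEnergyMin_ray hq (pos_of_betaOne_lt hq hβ) le_rfl hr0 hr1 hr

theorem isFreeEnergyMin_iff_exists_minimum (hq : 2 ≤ q) (hβ : betaOne q < β) {x : Fin q → ℝ} :
    IsFreeEnergyMin q β x ↔ ∃ i ∈ indexSet q β, x = minimum q β i := by
  have hβ0 := pos_of_betaOne_lt hq hβ
  constructor
  · intro h
    by_cases hb : x = barycentre q
    · refine ⟨none, none_mem_indexSet_iff.2 ?_, hb⟩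
      by_contra! hβq
      exact not_isFreeEnergyMin_barycentre hq hβ hβq (hb ▸ h)
    · obtain ⟨i, t, ht0, ht1, rfl, ht⟩ := h.exists_eq_ray hβ0 hb
      refine ⟨some i, some_mem_indexSet i, ?_⟩
      rw [minimum_some, orderParameter_eq hq ht0 ht1 ht]
      intro y hy hy0
      obtain ⟨r, hr0, hr1, hr⟩ := exists_meanField_neg_right_of_eq_zero
        (one_le_natCast_sub_one hq) ht0 hy.1 hy.2 ht hy0
      exact not_isFreeEnergyMin_ray hq hβ0 ht0.le hr0 hr1 hr h
  · rintro ⟨_ | i, hi, rfl⟩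
    · exact isFreeEnergyMin_barycentre (by lia) hβ0 (none_mem_indexSet_iff.1 hi)
    · exact isFreeEnergyMin_ray_orderParameter hq hβ i

/-- Local minima are finitely many, and a nearby point of equal free energy would be another. -/
lemma eventually_freeEnergy_minimum_lt (hq : 2 ≤ q) (hβ : betaOne q < β)
    {i : Option (Fin q)} (hi : i ∈ indexSet q β) :
    ∀ᶠ y in 𝓝 (minimum q β i), y ∈ stdSimplex ℝ (Fin q) → y ≠ minimum q β i →
      freeEnergy q β (minimum q β i) < freeEnergy q β y := by
  set m := minimum q β i
  have hmin := eventually_nhdsWithin_iff.1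
    ((isFreeEnergyMin_iff_exists_minimum hq hβ).2 ⟨i, hi, rfl⟩).2
  have hfin : (range (minimum q β) \ {m}).Finite := (finite_range _).sdiff
  have hisol : ∀ᶠ y in 𝓝 m, y ∉ range (minimum q β) \ {m} :=
    hfin.isClosed.isOpen_compl.mem_nhds fun h => h.2 rfl
  filter_upwards [hmin, eventually_eventually_nhds.2 hmin, hisol] with y hy hy' hrange hmem hne
  refine (hy hmem).lt_of_ne fun heq => hrange ⟨?_, hne⟩
  obtain ⟨j, -, hj⟩ := (isFreeEnergyMin_iff_exists_minimum hq hβ).1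
    ⟨hmem, eventually_nhdsWithin_iff.2 (heq ▸ hy')⟩
  exact ⟨j, hj.symm⟩

lemma minimum_mem_stdSimplex (hq : 2 ≤ q) (hβ : betaOne q < β) (i : Option (Fin q)) :
    minimum q β i ∈ stdSimplex ℝ (Fin q) := by
  obtain ⟨ht0, ht1⟩ := orderParameter_mem_Ioo hq hβ
  cases i with
  | none =>
    rw [minimum, ← ray_zero ⟨0, by lia⟩]
    exact ray_mem_stdSimplex _ le_rfl zero_le_one
  | some i => exact ray_mem_stdSimplex i ht0.le ht1.le

lemma minimum_apply_eq_iff (hq : 2 ≤ q) (hβ : betaOne q < β) {i : Option (Fin q)} {k : Fin q} :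
    minimum q β i k = (1 + ((q : ℝ) - 1) * orderParameter q β) / q ↔ i = some k := by
  have hc := one_le_natCast_sub_one hq
  have hq0 : (0 : ℝ) < q := by linarith
  obtain ⟨ht0, -⟩ := orderParameter_mem_Ioo hq hβ
  cases i with
  | none =>
    simp only [minimum, barycentre, div_left_inj' hq0.ne', reduceCtorEq, iff_false]
    nlinarith
  | some i =>
    rw [Option.some_inj, eq_comm (a := i)]
    refine ⟨fun h => ?_, fun h => if_pos h⟩
    by_contra hk
    simp only [minimum, if_neg hk, div_left_inj' hq0.ne'] at h
    nlinarith

lemma minimum_injective (hq : 2 ≤ q) (hβ : betaOne q < β) : Function.Injective (minimum q β) :=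
  fun i j h => Option.ext fun k => by
    rw [← minimum_apply_eq_iff hq hβ, h, minimum_apply_eq_iff hq hβ]

lemma minimum_lt_one (hq : 2 ≤ q) (hβ : betaOne q < β) (i : Option (Fin q)) (k : Fin q) :
    minimum q β i k < 1 := by
  obtain ⟨ht0, ht1⟩ := orderParameter_mem_Ioo hq hβ
  have hc := one_le_natCast_sub_one hq
  cases i with
  | none => rw [minimum, barycentre, div_lt_one (by linarith)]; linarith
  | some i =>
    simp only [minimum]
    split_ifs <;> rw [div_lt_one (by linarith)] <;> nlinarith

end Minima

variable {N q : ℕ}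

section ColourCount

/-- The number of spins of colour `k`, i.e. `N` times the empirical measure of `k`. -/
def colourCount (σ : Config N q) (k : Fin q) : ℕ := (Finset.univ.filter fun i => σ i = k).card

lemma empiricalMeasure_apply (σ : Config N q) (k : Fin q) :
    empiricalMeasure N q σ k = colourCount σ k / N := by
  simp [empiricalMeasure, colourCount, div_eq_inv_mul]

lemma sum_colourCount (σ : Config N q) : ∑ k, colourCount σ k = N := by
  have h := Finset.card_eq_sum_card_fiberwise (s := Finset.univ) (t := Finset.univ) (f := σ)
    fun _ _ => by simp
  simpa [colourCount] using h.symm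

lemma colourCount_le (σ : Config N q) (k : Fin q) : colourCount σ k ≤ N := by
  simpa [colourCount] using Finset.card_filter_le Finset.univ fun i => σ i = k

lemma exists_colourCount_eq {n : Fin q → ℕ} (hn : ∑ k, n k = N) :
    ∃ σ : Config N q, colourCount σ = n := by
  subst hn
  refine ⟨fun i => (finSigmaFinEquiv.symm i).1, funext fun k => ?_⟩
  calc colourCount (fun i => (finSigmaFinEquiv.symm i).1) k
      = (Finset.univ.filter fun p : Σ k, Fin (n k) => p.1 = k).card :=
        Finset.card_equiv finSigmaFinEquiv.symm (by simp)
    _ = Fintype.card (Fin (n k)) := by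
        rw [← Fintype.card_subtype, Fintype.card_congr (Equiv.sigmaSubtype k)]
    _ = n k := Fintype.card_fin _

lemma empiricalMeasure_mem_latticeSimplex (hN : 0 < N) (σ : Config N q) :
    empiricalMeasure N q σ ∈ latticeSimplex N q := by
  refine ⟨⟨fun k => ?_, ?_⟩, colourCount σ, empiricalMeasure_apply σ⟩
  · rw [empiricalMeasure_apply]; positivity
  · simp only [empiricalMeasure_apply, ← Finset.sum_div, ← Nat.cast_sum, sum_colourCount]
    exact div_self (by positivity)

lemma exists_empiricalMeasure_eq (hN : 0 < N) {z : Fin q → ℝ} (hz : z ∈ latticeSimplex N q) :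
    ∃ σ : Config N q, empiricalMeasure N q σ = z := by
  obtain ⟨hz, n, hzn⟩ := hz
  have hsum : ∑ k, n k = N := by
    have hmass := hz.2
    simp only [hzn, ← Finset.sum_div] at hmass
    rw [div_eq_one_iff_eq (by positivity)] at hmass
    exact_mod_cast hmass
  obtain ⟨σ, hσ⟩ := exists_colourCount_eq hsum
  exact ⟨σ, funext fun k => by rw [empiricalMeasure_apply, hσ, hzn]⟩

lemma empiricalMeasure_eq_iff (hN : 0 < N) (σ η : Config N q) :
    empiricalMeasure N q σ = empiricalMeasure N q η ↔ colourCount σ = colourCount η := by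
  have hN' : (N : ℝ) ≠ 0 := by positivity
  simp only [funext_iff, empiricalMeasure_apply, div_left_inj' hN', Nat.cast_inj]

lemma colourCount_le_add_hammingDist (σ η : Config N q) (k : Fin q) :
    colourCount σ k ≤ colourCount η k + hammingDist σ η := by
  refine (Finset.card_le_card fun i hi => ?_).trans (Finset.card_union_le _ _)
  simp only [Finset.mem_filter, Finset.mem_univ, true_and, Finset.mem_union] at hi ⊢
  by_cases h : σ i = η i
  · exact Or.inl (h ▸ hi)
  · exact Or.inr h

lemma abs_empiricalMeasure_sub_le (σ η : Config N q) (k : Fin q) :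
    |empiricalMeasure N q σ k - empiricalMeasure N q η k| ≤ hammingDist σ η / N := by
  rw [empiricalMeasure_apply, empiricalMeasure_apply, ← sub_div, abs_div, Nat.abs_cast]
  refine div_le_div_of_nonneg_right ?_ (Nat.cast_nonneg _)
  have hle : (colourCount σ k : ℝ) ≤ colourCount η k + hammingDist σ η := by
    exact_mod_cast colourCount_le_add_hammingDist σ η k
  have hge : (colourCount η k : ℝ) ≤ colourCount σ k + hammingDist σ η := by
    rw [hammingDist_comm]; exact_mod_cast colourCount_le_add_hammingDist η σ k
  rw [abs_le]
  constructor <;> linarith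

end ColourCount

section Hamiltonian

lemma sum_sum_ite_eq (σ : Config N q) :
    ∑ i, ∑ j, (if σ i = σ j then (1 : ℝ) else 0) = ∑ k, (colourCount σ k : ℝ) ^ 2 := by
  have hcount : ∀ i, ∑ j, (if σ i = σ j then (1 : ℝ) else 0) = colourCount σ (σ i) := fun i => by
    simp [colourCount, eq_comm]
  simp only [hcount]
  rw [← Finset.sum_fiberwise_of_maps_to (t := Finset.univ) (g := σ) fun _ _ => by simp]
  refine Finset.sum_congr rfl fun k _ => ?_
  rw [Finset.sum_congr rfl (g := fun _ => (colourCount σ k : ℝ)) fun i hi => by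
    rw [(Finset.mem_filter.1 hi).2], Finset.sum_const, nsmul_eq_mul, sq]
  rfl

lemma hamiltonian_eq (hN : 0 < N) (σ : Config N q) :
    hamiltonian N q σ = 1 / 2 - N / 2 * ∑ k, empiricalMeasure N q σ k ^ 2 := by
  have hsymm : ∑ i : Fin N, ∑ j : Fin N, (if j < i ∧ σ i = σ j then (1 : ℝ) else 0) =
      ∑ i : Fin N, ∑ j : Fin N, if i < j ∧ σ i = σ j then (1 : ℝ) else 0 := by
    rw [Finset.sum_comm]
    simp only [eq_comm]
  have hdiag : (N : ℝ) = ∑ i : Fin N, ∑ j : Fin N, if i = j then (1 : ℝ) else 0 := by simp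
  have hsplit : ∑ k, (colourCount σ k : ℝ) ^ 2 =
      ∑ i : Fin N, ∑ j : Fin N, (if i < j ∧ σ i = σ j then (1 : ℝ) else 0) +
      ∑ i : Fin N, ∑ j : Fin N, (if j < i ∧ σ i = σ j then (1 : ℝ) else 0) + N := by
    simp only [← sum_sum_ite_eq, hdiag, ← Finset.sum_add_distrib]
    refine Finset.sum_congr rfl fun i _ => Finset.sum_congr rfl fun j _ => ?_
    rcases lt_trichotomy i j with h | rfl | h
    · simp [h, h.ne, h.not_gt]
    · simp
    · simp [h, h.ne', h.not_gt]
  rw [hsymm] at hsplit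
  simp only [empiricalMeasure_apply, div_pow, ← Finset.sum_div, hsplit, hamiltonian]
  field_simp
  ring

lemma hamiltonian_sub_le (hN : 0 < N) {σ η : Config N q} (h : hammingDist σ η = 1) :
    hamiltonian N q η - hamiltonian N q σ ≤ q := by
  have hle (τ : Config N q) (k) : empiricalMeasure N q τ k ∈ Set.Icc (0 : ℝ) 1 :=
    mem_Icc_of_mem_stdSimplex (empiricalMeasure_mem_latticeSimplex hN τ).1 k
  have hk (k) : empiricalMeasure N q σ k ^ 2 - empiricalMeasure N q η k ^ 2 ≤ 2 / N := by
    have hdiff := (abs_le.1 (abs_empiricalMeasure_sub_le σ η k)).2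
    rw [h, Nat.cast_one] at hdiff
    calc empiricalMeasure N q σ k ^ 2 - empiricalMeasure N q η k ^ 2
        = (empiricalMeasure N q σ k - empiricalMeasure N q η k) *
          (empiricalMeasure N q σ k + empiricalMeasure N q η k) := by ring
      _ ≤ 1 / N * 2 := mul_le_mul hdiff (by linarith [(hle σ k).2, (hle η k).2])
          (add_nonneg (hle σ k).1 (hle η k).1) (by positivity)
      _ = 2 / N := by ring
  calc hamiltonian N q η - hamiltonian N q σ
      = N / 2 * ∑ k, (empiricalMeasure N q σ k ^ 2 - empiricalMeasure N q η k ^ 2) := by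
        rw [hamiltonian_eq hN, hamiltonian_eq hN, Finset.sum_sub_distrib]; ring
    _ ≤ N / 2 * ∑ _ : Fin q, (2 / N : ℝ) := by gcongr with k; exact hk k
    _ = q := by simp; field_simp

end Hamiltonian

section Gibbs

/-- The mass that the Gibbs measure gives to a configuration. -/
noncomputable def gibbsWeight (N q : ℕ) (β : ℝ≥0) (σ : Config N q) : ℝ :=
  Real.exp (-β * hamiltonian N q σ) / ∑ η, Real.exp (-β * hamiltonian N q η)

variable (β : ℝ≥0)

lemma gibbsWeight_pos (σ : Config N q) : 0 < gibbsWeight N q β σ :=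
  div_pos (Real.exp_pos _) (Finset.sum_pos (fun _ _ => Real.exp_pos _) ⟨σ, Finset.mem_univ σ⟩)

instance : IsFiniteMeasure (gibbs N q β) := by
  refine ⟨?_⟩
  rw [gibbs, Measure.finsetSum_apply]
  simp [ENNReal.sum_lt_top]

lemma gibbs_real_singleton (σ : Config N q) : (gibbs N q β).real {σ} = gibbsWeight N q β σ := by
  have h : gibbs N q β {σ} = ENNReal.ofReal (gibbsWeight N q β σ) := by
    rw [gibbs, Measure.finsetSum_apply]
    simp [Set.indicator_apply, gibbsWeight]
  rw [Measure.real, h, ENNReal.toReal_ofReal (gibbsWeight_pos β σ).le]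

open Classical in
lemma gibbs_real_eq_sum (A : Set (Config N q)) :
    (gibbs N q β).real A = ∑ σ with σ ∈ A, gibbsWeight N q β σ := by
  have h := sum_measureReal_singleton (μ := gibbs N q β) (Finset.univ.filter (· ∈ A))
  simpa [gibbs_real_singleton] using h.symm

lemma exp_mul_exp_max_sub_comm (a b : ℝ) :
    Real.exp (-β * a) * Real.exp (-β * max 0 (b - a)) =
      Real.exp (-β * b) * Real.exp (-β * max 0 (a - b)) := by
  rw [← Real.exp_add, ← Real.exp_add]
  congr 1
  rcases le_total a b with h | h
  · rw [max_eq_right (by linarith), max_eq_left (by linarith)]; ring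
  · rw [max_eq_left (by linarith), max_eq_right (by linarith)]; ring

lemma isReversible_glauber :
    MarkovChain.IsReversible (glauber N q β) (gibbsWeight N q β) := by
  intro σ η
  rcases eq_or_ne σ η with rfl | hne
  · rfl
  change gibbsWeight N q β σ * glauberMatrix N q β σ η =
    gibbsWeight N q β η * glauberMatrix N q β η σ
  rw [glauberMatrix, glauberMatrix, if_neg hne, if_neg hne.symm, flipProb, flipProb,
    hammingDist_comm η σ]
  split_ifs
  · have hdetailed := exp_mul_exp_max_sub_comm β (hamiltonian N q σ) (hamiltonian N q η)
    rw [gibbsWeight, gibbsWeight, div_mul_eq_mul_div, div_mul_eq_mul_div, mul_left_comm, hdetailed,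
      mul_left_comm]
  · rw [mul_zero, mul_zero]

lemma le_glauber_of_hammingDist_eq_one (hN : 0 < N) {σ η : Config N q}
    (h : hammingDist σ η = 1) :
    ((N : ℝ) * q)⁻¹ * Real.exp (-β * q) ≤ (glauber N q β).1 σ η := by
  have hne : σ ≠ η := by rintro rfl; simp at h
  have hmax : max 0 (hamiltonian N q η - hamiltonian N q σ) ≤ q :=
    max_le (Nat.cast_nonneg _) (hamiltonian_sub_le hN h)
  change _ ≤ glauberMatrix N q β σ η
  rw [glauberMatrix, flipProb, if_neg hne, if_pos h]
  gcongr ?_ * Real.exp ?_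
  nlinarith [β.coe_nonneg]

lemma glauber_eq_zero {σ η : Config N q} (hne : σ ≠ η) (h : hammingDist σ η ≠ 1) :
    (glauber N q β).1 σ η = 0 := by
  change glauberMatrix N q β σ η = 0
  rw [glauberMatrix, flipProb, if_neg hne, if_neg h]

end Gibbs

section Stirling

lemma mul_log_sub_le_log_factorial (n : ℕ) : n * Real.log n - n ≤ Real.log n.factorial := by
  rcases n.eq_zero_or_pos with rfl | hn
  · simp
  have hfact : (0 : ℝ) < n.factorial := by exact_mod_cast n.factorial_pos
  have h := Real.log_le_log (by positivity)
    (Real.pow_div_factorial_le_exp (n : ℝ) n.cast_nonneg n)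
  rw [Real.log_exp, Real.log_div (by positivity) hfact.ne', Real.log_pow] at h
  linarith

lemma log_factorial_le (n : ℕ) :
    Real.log n.factorial ≤ n * Real.log n - n + (1 + Real.log (n + 1)) := by
  rcases n.eq_zero_or_pos with rfl | hn
  · simp
  have hmono : Real.log n ≤ Real.log (n + 1) := Real.log_le_log (by positivity) (by linarith)
  suffices h : Real.log n.factorial ≤ n * Real.log n - n + (1 + Real.log n) by linarith
  clear hmono
  induction n, hn using Nat.le_induction with
  | base => simp
  | succ n hn ih =>
    have hstep : 1 ≤ (n + 1) * (Real.log (n + 1) - Real.log n) := by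
      have h := Real.one_sub_inv_le_log_of_pos (by positivity : (0 : ℝ) < (n + 1) / n)
      rw [Real.log_div (by positivity) (by positivity)] at h
      calc (1 : ℝ) = (n + 1) * (1 - ((n + 1 : ℝ) / n)⁻¹) := by field_simp; ring
        _ ≤ _ := by gcongr
    rw [Nat.factorial_succ, Nat.cast_mul, Real.log_mul (by positivity) (by positivity)]
    push_cast
    linarith

/-- The number of permutations of the sites fixing `σ`, inversely proportional to the number of
configurations with the same empirical measure as `σ`. -/
def symmetryCount (σ : Config N q) : ℕ := ∏ k, (colourCount σ k).factorial

lemma symmetryCount_pos (σ : Config N q) : 0 < symmetryCount σ :=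
  Finset.prod_pos fun _ _ => Nat.factorial_pos _

/-- The logarithmic error of the approximations `n! ≈ (n / e) ^ n` in `symmetryCount σ`. -/
noncomputable def stirlingError (σ : Config N q) : ℝ :=
  ∑ k, (Real.log (colourCount σ k).factorial -
    (colourCount σ k * Real.log (colourCount σ k) - colourCount σ k))

lemma stirlingError_nonneg (σ : Config N q) : 0 ≤ stirlingError σ :=
  Finset.sum_nonneg fun _ _ => sub_nonneg.2 (mul_log_sub_le_log_factorial _)

lemma stirlingError_le (σ : Config N q) : stirlingError σ ≤ q * (1 + Real.log (N + 1)) := by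
  calc stirlingError σ ≤ ∑ _ : Fin q, (1 + Real.log (N + 1)) := Finset.sum_le_sum fun k _ => by
        have hmono : Real.log (colourCount σ k + 1) ≤ Real.log (N + 1) := by
          gcongr; exact colourCount_le σ k
        linarith [log_factorial_le (colourCount σ k)]
    _ = q * (1 + Real.log (N + 1)) := by
      rw [Finset.sum_const, Finset.card_fin, nsmul_eq_mul]

lemma sum_colourCount_mul_log (hN : 0 < N) (σ : Config N q) :
    ∑ k, ((colourCount σ k : ℝ) * Real.log (colourCount σ k) - colourCount σ k) =
      N * ∑ k, empiricalMeasure N q σ k * Real.log (empiricalMeasure N q σ k) +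
        N * Real.log N - N := by
  have hsum : ∑ k, (colourCount σ k : ℝ) = N := by exact_mod_cast sum_colourCount σ
  have hterm : ∀ k, (colourCount σ k : ℝ) * Real.log (colourCount σ k) =
      N * (empiricalMeasure N q σ k * Real.log (empiricalMeasure N q σ k)) +
        colourCount σ k * Real.log N := fun k => by
    rw [empiricalMeasure_apply]
    rcases (colourCount σ k).eq_zero_or_pos with h | h
    · simp [h]
    · rw [Real.log_div (by positivity) (by positivity)]
      field_simp
      ring
  simp only [hterm, Finset.sum_sub_distrib, Finset.sum_add_distrib, ← Finset.sum_mul,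
    ← Finset.mul_sum, hsum]

lemma neg_mul_hamiltonian_sub_log_symmetryCount (hN : 0 < N) {β : ℝ} (hβ : 0 < β)
    (σ : Config N q) :
    -β * hamiltonian N q σ - Real.log (symmetryCount σ) =
      -(β * N * freeEnergy q β (empiricalMeasure N q σ)) - β / 2 - N * Real.log N + N -
        stirlingError σ := by
  have hlog : Real.log (symmetryCount σ) = ∑ k, Real.log (colourCount σ k).factorial := by
    rw [symmetryCount, Nat.cast_prod, Real.log_prod fun k _ => by positivity]
  rw [stirlingError, Finset.sum_sub_distrib, sum_colourCount_mul_log hN, ← hlog, hamiltonian_eq hN,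
    freeEnergy]
  field_simp
  ring

/-- Comparison of the Gibbs masses of the configurations with the empirical measures of `σ` and
of `η`, multiplied out. -/
lemma gibbsWeight_mul_symmetryCount_le (hN : 0 < N) {β : ℝ≥0} (hβ : 0 < β) (σ η : Config N q) :
    gibbsWeight N q β σ * symmetryCount η ≤
      (Real.exp 1 * (N + 1)) ^ q *
        Real.exp (β * N * (freeEnergy q β (empiricalMeasure N q η) -
          freeEnergy q β (empiricalMeasure N q σ))) *
        (gibbsWeight N q β η * symmetryCount σ) := by
  have hβ' : (0 : ℝ) < β := hβ
  have hexp (τ : Config N q) : (symmetryCount τ : ℝ) = Real.exp (Real.log (symmetryCount τ)) :=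
    (Real.exp_log (by exact_mod_cast symmetryCount_pos τ)).symm
  have hfactor : (Real.exp 1 * (N + 1)) ^ q = Real.exp (q * (1 + Real.log (N + 1))) := by
    rw [Real.exp_nat_mul, Real.exp_add, Real.exp_log (by positivity)]
  rw [gibbsWeight, gibbsWeight, div_mul_eq_mul_div, div_mul_eq_mul_div, mul_div_assoc', hexp σ,
    hexp η, hfactor]
  simp only [← Real.exp_add]
  refine div_le_div_of_nonneg_right (Real.exp_le_exp.2 ?_)
    (Finset.sum_nonneg fun _ _ => (Real.exp_pos _).le)
  linarith [neg_mul_hamiltonian_sub_log_symmetryCount hN hβ' σ, stirlingError_nonneg σ,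
    neg_mul_hamiltonian_sub_log_symmetryCount hN hβ' η, stirlingError_le η]

end Stirling

section Permutation

lemma colourCount_comp_perm (σ : Config N q) (π : Equiv.Perm (Fin N)) :
    colourCount (σ ∘ π) = colourCount σ :=
  funext fun k => Finset.card_equiv π (by simp)

lemma hammingDist_comp_perm (σ η : Config N q) (π : Equiv.Perm (Fin N)) :
    hammingDist (σ ∘ π) (η ∘ π) = hammingDist σ η :=
  Finset.card_equiv π (by simp)

lemma exists_perm_of_colourCount_eq {σ η : Config N q} (h : colourCount σ = colourCount η) :
    ∃ π : Equiv.Perm (Fin N), σ ∘ π = η := by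
  have hfibre (k) : Nonempty ({i // η i = k} ≃ {i // σ i = k}) := by
    refine Fintype.card_eq.1 ?_
    rw [Fintype.card_subtype, Fintype.card_subtype]
    exact (congrFun h k).symm
  replace hfibre := fun k => (hfibre k).some
  refine ⟨(Equiv.sigmaFiberEquiv η).symm.trans ((Equiv.sigmaCongrRight hfibre).trans
    (Equiv.sigmaFiberEquiv σ)), funext fun i => ?_⟩
  exact (hfibre (η i) ⟨i, rfl⟩).2

lemma card_perm_comp_self (σ : Config N q) :
    (Finset.univ.filter fun π : Equiv.Perm (Fin N) => σ ∘ π = σ).card = symmetryCount σ := by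
  rw [← Fintype.card_subtype, DomMulAct.stabilizer_card]
  exact Finset.prod_congr rfl fun k _ => by rw [Fintype.card_subtype, colourCount]

lemma card_perm_comp_eq {σ η : Config N q} (h : colourCount σ = colourCount η) :
    (Finset.univ.filter fun π : Equiv.Perm (Fin N) => σ ∘ π = η).card = symmetryCount σ := by
  obtain ⟨π₀, rfl⟩ := exists_perm_of_colourCount_eq h
  rw [← card_perm_comp_self]
  refine Finset.card_equiv (Equiv.mulRight π₀⁻¹) fun π => ?_
  simp only [Finset.mem_filter, Finset.mem_univ, true_and, Equiv.coe_mulRight, Equiv.Perm.coe_mul,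
    ← Function.comp_assoc]
  exact (Equiv.comp_symm_eq π₀ σ (σ ∘ π)).symm

end Permutation

section ColourClass

/-- The configurations with the same colour counts as `σ`, i.e. the orbit of `σ` under the
permutations of the sites. -/
def colourClass (σ : Config N q) : Finset (Config N q) :=
  Finset.univ.filter fun η => colourCount η = colourCount σ

lemma mem_colourClass {σ η : Config N q} :
    η ∈ colourClass σ ↔ colourCount η = colourCount σ := by
  simp [colourClass]

lemma sum_perm_comp (σ : Config N q) (f : Config N q → ℝ) :
    ∑ π : Equiv.Perm (Fin N), f (σ ∘ π) = symmetryCount σ * ∑ η ∈ colourClass σ, f η := by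
  have hmaps (π : Equiv.Perm (Fin N)) (_ : π ∈ Finset.univ) : σ ∘ π ∈ colourClass σ :=
    mem_colourClass.2 (colourCount_comp_perm σ π)
  rw [← Finset.sum_fiberwise_of_maps_to hmaps, Finset.mul_sum]
  refine Finset.sum_congr rfl fun η hη => ?_
  rw [← card_perm_comp_eq (mem_colourClass.1 hη).symm, ← nsmul_eq_mul]
  exact Finset.sum_eq_card_nsmul fun π hπ => by rw [(Finset.mem_filter.1 hπ).2]

lemma symmetryCount_mul_card_colourClass (σ : Config N q) :
    (symmetryCount σ : ℝ) * (colourClass σ).card = N.factorial := by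
  simpa [Fintype.card_perm] using (sum_perm_comp σ fun _ => 1).symm

lemma gibbsWeight_congr (hN : 0 < N) (β : ℝ≥0) {σ η : Config N q}
    (h : colourCount σ = colourCount η) : gibbsWeight N q β σ = gibbsWeight N q β η := by
  rw [gibbsWeight, gibbsWeight, hamiltonian_eq hN σ, hamiltonian_eq hN η,
    (empiricalMeasure_eq_iff hN σ η).2 h]

end ColourClass

section Path

/-- The sum of the squared increments of `u` over the single-site changes of `σ`. -/
noncomputable def sqGradient (u : Config N q → ℝ) (σ : Config N q) : ℝ :=
  ∑ η with hammingDist σ η = 1, (u σ - u η) ^ 2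

lemma sqGradient_nonneg (u : Config N q → ℝ) (σ : Config N q) : 0 ≤ sqGradient u σ :=
  Finset.sum_nonneg fun _ _ => sq_nonneg _

lemma sq_sub_le_sqGradient (u : Config N q → ℝ) {σ η : Config N q} (h : hammingDist σ η = 1) :
    (u η - u σ) ^ 2 ≤ sqGradient u σ := by
  rw [sub_sq_comm]
  exact Finset.single_le_sum (f := fun η => (u σ - u η) ^ 2) (fun _ _ => sq_nonneg _)
    (Finset.mem_filter.2 ⟨Finset.mem_univ η, h⟩)

lemma sum_perm_sq_sub_le (u : Config N q → ℝ) {σ η : Config N q} (h : hammingDist σ η = 1) :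
    ∑ π : Equiv.Perm (Fin N), (u (η ∘ π) - u (σ ∘ π)) ^ 2 ≤
      symmetryCount σ * ∑ ξ ∈ colourClass σ, sqGradient u ξ := by
  rw [← sum_perm_comp]
  exact Finset.sum_le_sum fun π _ =>
    sq_sub_le_sqGradient u ((hammingDist_comp_perm σ η π).trans h)

lemma sq_sub_le_mul_sum_sq_sub (f : ℕ → ℝ) (n : ℕ) :
    (f n - f 0) ^ 2 ≤ n * ∑ k ∈ Finset.range n, (f (k + 1) - f k) ^ 2 := by
  rw [← Finset.sum_range_sub, ← Finset.card_range n]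
  simpa using sq_sum_le_card_mul_sum_sq (s := Finset.range n) (f := fun k => f (k + 1) - f k)

lemma card_mul_symmetryCount_le {u : Config N q → ℝ} {n : ℕ} {s : ℕ → Config N q}
    (hs : ∀ k < n, hammingDist (s k) (s (k + 1)) = 1) {X : Finset (Config N q)}
    (hX : X ⊆ colourClass (s 0)) (hu0 : ∀ σ ∈ X, u σ = 0) (hu1 : ∀ σ ∈ colourClass (s n), u σ = 1) :
    (symmetryCount (s 0) : ℝ) * X.card ≤
      n * ∑ k ∈ Finset.range n, symmetryCount (s k) * ∑ σ ∈ colourClass (s k), sqGradient u σ := by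
  classical
  have hpath (π : Equiv.Perm (Fin N)) : (if s 0 ∘ π ∈ X then (1 : ℝ) else 0) ≤
      n * ∑ k ∈ Finset.range n, (u (s (k + 1) ∘ π) - u (s k ∘ π)) ^ 2 := by
    split_ifs with h
    · have hn : u (s n ∘ π) = 1 := hu1 _ (mem_colourClass.2 (colourCount_comp_perm (s n) π))
      simpa [hn, hu0 _ h] using sq_sub_le_mul_sum_sq_sub (fun k => u (s k ∘ π)) n
    · positivity
  calc (symmetryCount (s 0) : ℝ) * X.card
      = ∑ π : Equiv.Perm (Fin N), if s 0 ∘ π ∈ X then (1 : ℝ) else 0 := by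
        rw [sum_perm_comp (s 0) fun σ => if σ ∈ X then (1 : ℝ) else 0, Finset.sum_ite_mem,
          Finset.inter_eq_right.2 hX, Finset.sum_const, nsmul_one]
    _ ≤ ∑ π : Equiv.Perm (Fin N),
          n * ∑ k ∈ Finset.range n, (u (s (k + 1) ∘ π) - u (s k ∘ π)) ^ 2 :=
        Finset.sum_le_sum fun π _ => hpath π
    _ = n * ∑ k ∈ Finset.range n,
          ∑ π : Equiv.Perm (Fin N), (u (s (k + 1) ∘ π) - u (s k ∘ π)) ^ 2 := by
        rw [← Finset.mul_sum, Finset.sum_comm]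
    _ ≤ _ := by
        gcongr with k hk
        exact sum_perm_sq_sub_le u (hs k (Finset.mem_range.1 hk))

lemma gibbsWeight_mul_sqGradient_le (hN : 0 < N) (β : ℝ≥0) (u : Config N q → ℝ)
    (σ : Config N q) :
    gibbsWeight N q β σ * sqGradient u σ ≤
      N * q * Real.exp (β * q) *
        ∑ η, gibbsWeight N q β σ * (glauber N q β).1 σ η * (u σ - u η) ^ 2 := by
  have hw := (gibbsWeight_pos β σ).le
  have hP := (glauber N q β).2.1 σ
  rw [sqGradient, Finset.mul_sum, Finset.mul_sum]
  refine (Finset.sum_le_sum fun η hη => ?_).trans <| Finset.sum_le_sum_of_subset_of_nonneg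
    (Finset.filter_subset _ _) fun η _ _ => by have := hP η; positivity
  have hflip := le_glauber_of_hammingDist_eq_one β hN (Finset.mem_filter.1 hη).2
  have hq : 0 < q := (σ ⟨0, hN⟩).pos
  have hone : 1 ≤ N * q * Real.exp (β * q) * (glauber N q β).1 σ η := by
    calc (1 : ℝ) = N * q * Real.exp (β * q) * ((N * q : ℝ)⁻¹ * Real.exp (-β * q)) := by
          rw [neg_mul, Real.exp_neg]; field_simp
      _ ≤ _ := by gcongr
  calc gibbsWeight N q β σ * (u σ - u η) ^ 2
      = 1 * (gibbsWeight N q β σ * (u σ - u η) ^ 2) := (one_mul _).symm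
    _ ≤ N * q * Real.exp (β * q) * (glauber N q β).1 σ η *
          (gibbsWeight N q β σ * (u σ - u η) ^ 2) := by gcongr
    _ = _ := by ring

lemma gibbsWeight_mul_sum_sqGradient_le (hN : 0 < N) (β : ℝ≥0) (u : Config N q → ℝ)
    (σ : Config N q) :
    gibbsWeight N q β σ * ∑ η ∈ colourClass σ, sqGradient u η ≤
      2 * N * q * Real.exp (β * q) *
        MarkovChain.dirichletForm (glauber N q β) (gibbsWeight N q β) u u := by
  calc gibbsWeight N q β σ * ∑ η ∈ colourClass σ, sqGradient u η
      = ∑ η ∈ colourClass σ, gibbsWeight N q β η * sqGradient u η := by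
        rw [Finset.mul_sum]
        exact Finset.sum_congr rfl fun η hη => by
          rw [gibbsWeight_congr hN β (mem_colourClass.1 hη)]
    _ ≤ ∑ η, gibbsWeight N q β η * sqGradient u η :=
        Finset.sum_le_sum_of_subset_of_nonneg (Finset.subset_univ _) fun η _ _ =>
          mul_nonneg (gibbsWeight_pos β η).le (sqGradient_nonneg u η)
    _ ≤ ∑ η, N * q * Real.exp (β * q) *
          ∑ ξ, gibbsWeight N q β η * (glauber N q β).1 η ξ * (u η - u ξ) ^ 2 :=
        Finset.sum_le_sum fun η _ => gibbsWeight_mul_sqGradient_le hN β u η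
    _ = _ := by
        simp only [MarkovChain.dirichletForm, ← Finset.mul_sum, sq]
        ring

lemma gibbsWeight_mul_symmetryCount_mul_sum_sqGradient_le (hN : 0 < N) {β : ℝ≥0} (hβ : 0 < β)
    (u : Config N q → ℝ) {σ η : Config N q} {ε : ℝ}
    (hlevel : freeEnergy q β (empiricalMeasure N q η) ≤
      freeEnergy q β (empiricalMeasure N q σ) + ε) :
    gibbsWeight N q β σ * (symmetryCount η * ∑ ξ ∈ colourClass η, sqGradient u ξ) ≤
      symmetryCount σ * ((Real.exp 1 * (N + 1)) ^ q * Real.exp (β * N * ε) *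
        (2 * N * q * Real.exp (β * q) *
          MarkovChain.dirichletForm (glauber N q β) (gibbsWeight N q β) u u)) := by
  set g := ∑ ξ ∈ colourClass η, sqGradient u ξ
  set K := (Real.exp 1 * (N + 1)) ^ q * Real.exp (β * N * ε)
  have hK : gibbsWeight N q β σ * symmetryCount η ≤
      K * (gibbsWeight N q β η * symmetryCount σ) := by
    refine (gibbsWeight_mul_symmetryCount_le hN hβ σ η).trans ?_
    have hw := (gibbsWeight_pos β η).le
    unfold K
    gcongr
    linarith
  calc gibbsWeight N q β σ * (symmetryCount η * g)
      = gibbsWeight N q β σ * symmetryCount η * g := by ring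
    _ ≤ K * (gibbsWeight N q β η * symmetryCount σ) * g :=
        mul_le_mul_of_nonneg_right hK (Finset.sum_nonneg fun ξ _ => sqGradient_nonneg u ξ)
    _ = symmetryCount σ * (K * (gibbsWeight N q β η * g)) := by ring
    _ ≤ _ := by
        refine mul_le_mul_of_nonneg_left (mul_le_mul_of_nonneg_left ?_ ?_) (Nat.cast_nonneg _)
        · exact gibbsWeight_mul_sum_sqGradient_le hN β u η
        · positivity

lemma card_mul_gibbsWeight_le (hN : 0 < N) {β : ℝ≥0} (hβ : 0 < β)
    {u : Config N q → ℝ} {n : ℕ} {s : ℕ → Config N q} {ε : ℝ}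
    (hs : ∀ k < n, hammingDist (s k) (s (k + 1)) = 1)
    (hlevel : ∀ k < n, freeEnergy q β (empiricalMeasure N q (s k)) ≤
      freeEnergy q β (empiricalMeasure N q (s 0)) + ε) {X : Finset (Config N q)}
    (hX : X ⊆ colourClass (s 0)) (hu0 : ∀ σ ∈ X, u σ = 0) (hu1 : ∀ σ ∈ colourClass (s n), u σ = 1) :
    X.card * gibbsWeight N q β (s 0) ≤
      n ^ 2 * ((Real.exp 1 * (N + 1)) ^ q * Real.exp (β * N * ε)) *
        (2 * N * q * Real.exp (β * q) *
          MarkovChain.dirichletForm (glauber N q β) (gibbsWeight N q β) u u) := by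
  set K := (Real.exp 1 * (N + 1)) ^ q * Real.exp (β * N * ε)
  set D := 2 * N * q * Real.exp (β * q) *
    MarkovChain.dirichletForm (glauber N q β) (gibbsWeight N q β) u u
  set g : ℕ → ℝ := fun k => ∑ σ ∈ colourClass (s k), sqGradient u σ
  have hstep (k) (hk : k < n) :
      gibbsWeight N q β (s 0) * (symmetryCount (s k) * g k) ≤ symmetryCount (s 0) * (K * D) :=
    gibbsWeight_mul_symmetryCount_mul_sum_sqGradient_le hN hβ u (hlevel k hk)
  have hsymm : (0 : ℝ) < symmetryCount (s 0) := mod_cast symmetryCount_pos (s 0)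
  refine le_of_mul_le_mul_left ?_ hsymm
  calc (symmetryCount (s 0) : ℝ) * (X.card * gibbsWeight N q β (s 0))
      = gibbsWeight N q β (s 0) * (symmetryCount (s 0) * X.card) := by ring
    _ ≤ gibbsWeight N q β (s 0) * (n * ∑ k ∈ Finset.range n, symmetryCount (s k) * g k) :=
        mul_le_mul_of_nonneg_left (card_mul_symmetryCount_le hs hX hu0 hu1)
          (gibbsWeight_pos β (s 0)).le
    _ = n * ∑ k ∈ Finset.range n, gibbsWeight N q β (s 0) * (symmetryCount (s k) * g k) := by
        rw [← Finset.mul_sum]; ring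
    _ ≤ n * ∑ _k ∈ Finset.range n, symmetryCount (s 0) * (K * D) := by
        refine mul_le_mul_of_nonneg_left (Finset.sum_le_sum fun k hk => ?_) (Nat.cast_nonneg n)
        exact hstep k (Finset.mem_range.1 hk)
    _ = _ := by rw [Finset.sum_const, Finset.card_range, nsmul_eq_mul]; ring

end Path

lemma exists_sum_eq_abs_sub_le {ι : Type*} [Fintype ι] {w : ι → ℝ} (hw : ∀ k, 0 ≤ w k)
    (hsum : ∑ k, w k = N) :
    ∃ n : ι → ℕ, ∑ k, n k = N ∧ ∀ k, |n k - w k| ≤ Fintype.card ι := by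
  classical
  rcases isEmpty_or_nonempty ι with hι | ⟨⟨i⟩⟩
  · exact ⟨fun _ => 0, by simpa [eq_comm] using hsum, isEmptyElim⟩
  have hlow (k) : (⌊w k⌋₊ : ℝ) ≤ w k := Nat.floor_le (hw k)
  have hupp (k) : w k ≤ ⌊w k⌋₊ + 1 := (Nat.lt_floor_add_one (w k)).le
  have hle : ∑ k, ⌊w k⌋₊ ≤ N := by
    rw [← Nat.cast_le (α := ℝ), Nat.cast_sum, ← hsum]
    exact Finset.sum_le_sum fun k _ => hlow k
  obtain ⟨r, hr⟩ := Nat.exists_eq_add_of_le hle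
  have hr_le : (r : ℝ) ≤ Fintype.card ι := by
    have h := Finset.sum_le_sum fun k (_ : k ∈ Finset.univ) => hupp k
    rw [hsum, hr, Finset.sum_add_distrib] at h
    push_cast at h
    simpa using h
  have hcard : (1 : ℝ) ≤ Fintype.card ι := mod_cast Fintype.card_pos_iff.2 ⟨i⟩
  refine ⟨fun k => ⌊w k⌋₊ + if k = i then r else 0, ?_, fun k => ?_⟩
  · simp [Finset.sum_add_distrib, hr]
  · have : (0 : ℝ) ≤ r := Nat.cast_nonneg r
    rw [abs_le]
    dsimp only
    split_ifs <;> push_cast <;> constructor <;> linarith [hlow k, hupp k]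

lemma exists_latticeSimplex_dist_le (hN : 0 < N) {w : Fin q → ℝ} (hw : w ∈ stdSimplex ℝ (Fin q)) :
    ∃ z ∈ latticeSimplex N q, dist z w ≤ q / N := by
  have hN' : (0 : ℝ) < N := by exact_mod_cast hN
  obtain ⟨n, hn, hnw⟩ := exists_sum_eq_abs_sub_le (N := N) (w := fun k => N * w k)
    (fun k => mul_nonneg hN'.le (hw.1 k)) (by rw [← Finset.mul_sum, hw.2, mul_one])
  refine ⟨fun k => n k / N, ⟨⟨fun k => by positivity, ?_⟩, n, fun k => rfl⟩, ?_⟩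
  · rw [← Finset.sum_div, ← Nat.cast_sum, hn, div_self hN'.ne']
  · refine (dist_pi_le_iff (by positivity)).2 fun k => ?_
    rw [Real.dist_eq, div_sub' hN'.ne', abs_div, Nat.abs_cast]
    exact div_le_div_of_nonneg_right (by simpa using hnw k) hN'.le

lemma IsClosestLatticePoint.dist_le (hN : 0 < N) {x y : Fin q → ℝ}
    (hx : x ∈ stdSimplex ℝ (Fin q)) (h : IsClosestLatticePoint N q x y) :
    dist y x ≤ q * (q / N) := by
  obtain ⟨z, hz, hzx⟩ := exists_latticeSimplex_dist_le hN hx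
  refine (dist_pi_le_iff (by positivity)).2 fun k => abs_le_of_sq_le_sq ?_ (by positivity)
  have hq : (q : ℝ) ≤ q ^ 2 := by exact_mod_cast Nat.le_self_pow two_ne_zero q
  calc (y k - x k) ^ 2 ≤ ∑ k, (y k - x k) ^ 2 :=
        Finset.single_le_sum (f := fun k => (y k - x k) ^ 2) (fun _ _ => sq_nonneg _)
          (Finset.mem_univ k)
    _ ≤ ∑ k, (z k - x k) ^ 2 := h.2 z hz
    _ ≤ ∑ _k : Fin q, (q / N : ℝ) ^ 2 := Finset.sum_le_sum fun k _ =>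
        sq_le_sq.2 <| ((dist_le_pi_dist z x k).trans hzx).trans (le_abs_self _)
    _ = q * (q / N : ℝ) ^ 2 := by simp
    _ ≤ q ^ 2 * (q / N : ℝ) ^ 2 := by gcongr
    _ = _ := (mul_pow _ _ _).symm

lemma eventually_dist_lt_of_isClosestLatticePoint (q : ℕ) {δ : ℝ} (hδ : 0 < δ) :
    ∀ᶠ N : ℕ in atTop, ∀ x ∈ stdSimplex ℝ (Fin q), ∀ y,
      IsClosestLatticePoint N q x y → dist y x < δ := by
  have hlim : Tendsto (fun N : ℕ => (q : ℝ) * (q / N)) atTop (𝓝 0) := by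
    simpa using (tendsto_const_div_atTop_nhds_zero_nat (q : ℝ)).const_mul (q : ℝ)
  filter_upwards [hlim.eventually_lt_const hδ, eventually_gt_atTop 0] with N hlt hN x hx y hy
  exact (hy.dist_le hN hx).trans_lt hlt

lemma exists_tendsto_latticeSimplex {N : ℕ → ℕ} (hN : Tendsto N atTop atTop) {w : Fin q → ℝ}
    (hw : w ∈ stdSimplex ℝ (Fin q)) :
    ∃ z : ℕ → Fin q → ℝ, Tendsto z atTop (𝓝 w) ∧ ∀ᶠ n in atTop, z n ∈ latticeSimplex (N n) q := by
  have h (n) : ∃ z, 0 < N n → z ∈ latticeSimplex (N n) q ∧ dist z w ≤ q / N n := by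
    by_cases hn : 0 < N n
    · obtain ⟨z, hz⟩ := exists_latticeSimplex_dist_le hn hw
      exact ⟨z, fun _ => hz⟩
    · exact ⟨w, fun hn' => absurd hn' hn⟩
  choose z hz using h
  have hpos : ∀ᶠ n in atTop, 0 < N n := hN.eventually_gt_atTop 0
  refine ⟨z, tendsto_iff_dist_tendsto_zero.2 ?_, hpos.mono fun n hn => (hz n hn).1⟩
  exact squeeze_zero' (Eventually.of_forall fun _ => dist_nonneg)
    (hpos.mono fun n hn => (hz n hn).2)
    ((tendsto_const_div_atTop_nhds_zero_nat (q : ℝ)).comp hN)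

lemma isLocalMinOn_of_tendsto_of_latticeSimplex {f : (Fin q → ℝ) → ℝ} (hf : Continuous f)
    {N : ℕ → ℕ} (hN : Tendsto N atTop atTop) {y : ℕ → Fin q → ℝ} {x : Fin q → ℝ}
    (hy : Tendsto y atTop (𝓝 x)) {δ : ℝ} (hδ : 0 < δ)
    (hmin : ∀ n, ∀ z ∈ latticeSimplex (N n) q, dist z (y n) < δ → f (y n) ≤ f z) :
    IsLocalMinOn f (stdSimplex ℝ (Fin q)) x := by
  filter_upwards [self_mem_nhdsWithin, nhdsWithin_le_nhds (Metric.ball_mem_nhds x hδ)] with w hw hwx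
  obtain ⟨z, hz, hzN⟩ := exists_tendsto_latticeSimplex hN hw
  refine le_of_tendsto_of_tendsto ((hf.tendsto x).comp hy) ((hf.tendsto w).comp hz) ?_
  filter_upwards [hzN, (hz.dist hy).eventually_lt_const hwx] with n hn hlt
  exact hmin n _ hn hlt

lemma eventually_exists_dist_minimum_lt (hq : 2 ≤ q) {β : ℝ} (hβ : betaOne q < β)
    {δ r : ℝ} (hδ : 0 < δ) (hr : 0 < r) :
    ∀ᶠ N : ℕ in atTop, ∀ y ∈ latticeSimplex N q,
      (∀ z ∈ latticeSimplex N q, dist z y < δ → freeEnergy q β y ≤ freeEnergy q β z) →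
      ∃ i ∈ indexSet q β, dist y (minimum q β i) < r := by
  by_contra hfreq
  obtain ⟨N, hN, h⟩ := extraction_of_frequently_atTop (not_eventually.1 hfreq)
  push Not at h
  choose y hy hmin hfar using h
  obtain ⟨x, hx, φ, hφ, hlim⟩ := (isCompact_stdSimplex ℝ (Fin q)).tendsto_subseq fun n => (hy n).1
  have hloc : IsFreeEnergyMin q β x :=
    ⟨hx, isLocalMinOn_of_tendsto_of_latticeSimplex (continuous_freeEnergy q β)
      (hN.tendsto_atTop.comp hφ.tendsto_atTop) hlim hδ fun n => hmin (φ n)⟩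
  obtain ⟨i, hi, rfl⟩ := (isFreeEnergyMin_iff_exists_minimum hq hβ).1 hloc
  obtain ⟨n, hn⟩ :=
    ((tendsto_iff_dist_tendsto_zero.1 hlim).eventually_lt_const hr).exists
  exact hn.not_ge (hfar (φ n) i hi)

section SingleSite

lemma hammingDist_update {σ : Config N q} {i : Fin N} {b : Fin q} (h : σ i ≠ b) :
    hammingDist σ (Function.update σ i b) = 1 := by
  refine Finset.card_eq_one.2 ⟨i, Finset.ext fun j => ?_⟩
  rcases eq_or_ne j i with rfl | hj <;> simp [*]

lemma hammingDist_update_apply {σ η : Config N q} {i : Fin N} (h : σ i ≠ η i) :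
    hammingDist (Function.update σ i (η i)) η + 1 = hammingDist σ η := by
  have hi : i ∈ Finset.univ.filter fun j => σ j ≠ η j := by simpa using h
  rw [hammingDist, hammingDist, ← Finset.card_erase_add_one hi]
  congr 2
  ext j
  rcases eq_or_ne j i with rfl | hj <;> simp [*]

lemma colourCount_update (σ : Config N q) (i : Fin N) (b k : Fin q) :
    colourCount (Function.update σ i b) k + (if σ i = k then 1 else 0) =
      colourCount σ k + if b = k then 1 else 0 := by
  have herase : ∑ j ∈ Finset.univ.erase i, (if Function.update σ i b j = k then 1 else 0) =
      ∑ j ∈ Finset.univ.erase i, if σ j = k then 1 else 0 :=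
    Finset.sum_congr rfl fun j hj => by rw [Function.update_of_ne (Finset.ne_of_mem_erase hj)]
  simp only [colourCount, Finset.card_filter]
  rw [← Finset.add_sum_erase _ _ (Finset.mem_univ i),
    ← Finset.add_sum_erase _ _ (Finset.mem_univ i), herase, Function.update_self]
  ring

lemma exists_lt_colourCount {n : Fin q → ℕ} (hn : ∑ k, n k = N) {σ : Config N q} {b : Fin q}
    (hb : colourCount σ b < n b) : ∃ i, n (σ i) < colourCount σ (σ i) := by
  by_contra! hcon
  have hle (k) : colourCount σ k ≤ n k := by
    rcases Finset.eq_empty_or_nonempty (Finset.univ.filter fun i => σ i = k) with h | ⟨i, hi⟩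
    · simp [colourCount, h]
    · exact (Finset.mem_filter.1 hi).2 ▸ hcon i
  have hlt := Finset.sum_lt_sum (fun k _ => hle k) ⟨b, Finset.mem_univ b, hb⟩
  rw [hn, sum_colourCount] at hlt
  exact hlt.false

lemma exists_colourCount_eq_hammingDist_le {n : Fin q → ℕ} (hn : ∑ k, n k = N) (σ : Config N q) :
    ∃ η, colourCount η = n ∧ hammingDist σ η ≤ ∑ k, (n k - colourCount σ k) := by
  induction hd : ∑ k, (n k - colourCount σ k) using Nat.strong_induction_on generalizing σ with
  | _ d ih =>
    subst hd
    by_cases hall : ∀ k, n k ≤ colourCount σ k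
    · have hsum : ∑ k, n k = ∑ k, colourCount σ k := by rw [hn, sum_colourCount]
      refine ⟨σ, funext fun k => ?_, by simp⟩
      exact ((Finset.sum_eq_sum_iff_of_le fun k _ => hall k).1 hsum k (Finset.mem_univ k)).symm
    push Not at hall
    obtain ⟨b, hb⟩ := hall
    obtain ⟨i, hi⟩ := exists_lt_colourCount hn hb
    have hib : σ i ≠ b := by rintro rfl; lia
    set σ' := Function.update σ i b
    have hlt : ∑ k, (n k - colourCount σ' k) < ∑ k, (n k - colourCount σ k) := by
      refine Finset.sum_lt_sum (fun k _ => ?_) ⟨b, Finset.mem_univ b, ?_⟩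
      · have hcount := colourCount_update σ i b k
        split_ifs at hcount with hik hbk hbk
        all_goals subst_vars; lia
      · have hcount := colourCount_update σ i b b
        rw [if_neg hib, if_pos rfl] at hcount
        lia
    obtain ⟨η, hη, hdist⟩ := ih _ hlt σ' rfl
    refine ⟨η, hη, ?_⟩
    have htri := hammingDist_triangle σ σ' η
    rw [hammingDist_update hib] at htri
    lia

end SingleSite

section LevelGraph

/-- The graph on configurations whose edges are the single-site changes within a sublevel set of
the free energy. -/
def levelGraph (N q : ℕ) (β c : ℝ) : SimpleGraph (Config N q) where
  Adj σ η := hammingDist σ η = 1 ∧ freeEnergy q β (empiricalMeasure N q σ) ≤ c ∧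
    freeEnergy q β (empiricalMeasure N q η) ≤ c
  symm := ⟨fun _ _ h => ⟨(hammingDist_comm _ _).trans h.1, h.2.symm⟩⟩
  loopless := ⟨fun σ h => by simpa using h.1⟩

variable {β c : ℝ}

lemma reachable_levelGraph {σ η : Config N q}
    (h : ∀ τ, hammingDist τ η ≤ hammingDist σ η → freeEnergy q β (empiricalMeasure N q τ) ≤ c) :
    (levelGraph N q β c).Reachable σ η := by
  induction hd : hammingDist σ η generalizing σ with
  | zero => rw [hammingDist_eq_zero.1 hd]
  | succ d ih =>
    obtain ⟨i, hi⟩ : ∃ i, σ i ≠ η i := by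
      rw [← Function.ne_iff, ← hammingDist_pos, hd]
      exact d.succ_pos
    have hdist := hammingDist_update_apply hi
    refine SimpleGraph.Reachable.trans (SimpleGraph.Adj.reachable ?_)
      (ih (σ := Function.update σ i (η i)) (fun τ hτ => h τ (by lia)) (by lia))
    exact ⟨hammingDist_update hi, h σ le_rfl, h _ (by lia)⟩

/-- The colour counts of a configuration as an element of a finite type, so that self-avoiding
paths of colour counts have polynomial length. -/
def colourVector (σ : Config N q) : Fin q → Fin (N + 1) := fun k =>
  ⟨colourCount σ k, Nat.lt_succ_of_le (colourCount_le σ k)⟩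

lemma colourVector_eq_iff {σ η : Config N q} :
    colourVector σ = colourVector η ↔ colourCount σ = colourCount η := by
  simp [colourVector, funext_iff]

lemma reachable_map {V W : Type*} {G : SimpleGraph V} (f : V → W) {u v : V} (h : G.Reachable u v) :
    (G.map f).Reachable (f u) (f v) := by
  obtain ⟨p⟩ := h
  induction p with
  | nil => rfl
  | @cons u v _ hadj _ ih =>
    refine SimpleGraph.Reachable.trans ?_ ih
    by_cases huv : f u = f v
    · rw [huv]
    · exact (SimpleGraph.map_adj_apply' hadj huv).reachable

lemma exists_path_of_walk (hN : 0 < N) {y z : Fin q → Fin (N + 1)}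
    (p : ((levelGraph N q β c).map colourVector).Walk y z) (σ : Config N q)
    (hσ : colourVector σ = y) :
    ∃ s : ℕ → Config N q, s 0 = σ ∧ colourVector (s p.length) = z ∧
      ∀ k < p.length, (levelGraph N q β c).Adj (s k) (s (k + 1)) := by
  induction p generalizing σ with
  | nil => exact ⟨fun _ => σ, rfl, hσ, by simp⟩
  | cons hadj p ih =>
    obtain ⟨-, σ', η', ⟨hd, hσc, hηc⟩, hσ', hη'⟩ := hadj
    have hcount : colourCount σ' = colourCount σ := by rw [← colourVector_eq_iff, hσ', hσ]
    obtain ⟨π, rfl⟩ := exists_perm_of_colourCount_eq hcount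
    have hπ (τ : Config N q) : empiricalMeasure N q (τ ∘ π) = empiricalMeasure N q τ :=
      (empiricalMeasure_eq_iff hN _ _).2 (colourCount_comp_perm τ π)
    obtain ⟨s, hs0, hsn, hs⟩ := ih (η' ∘ π)
      ((colourVector_eq_iff.2 (colourCount_comp_perm η' π)).trans hη')
    refine ⟨fun | 0 => σ' ∘ π | k + 1 => s k, rfl, hsn, fun k hk => ?_⟩
    cases k with
    | zero =>
      change (levelGraph N q β c).Adj (σ' ∘ π) (s 0)
      rw [hs0]
      exact ⟨(hammingDist_comp_perm σ' η' π).trans hd, by rwa [hπ], by rwa [hπ]⟩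
    | succ k => exact hs k (Nat.lt_of_succ_lt_succ hk)

lemma exists_path_of_reachable (hN : 0 < N) {σ η : Config N q}
    (h : (levelGraph N q β c).Reachable σ η) :
    ∃ n ≤ (N + 1) ^ q, ∃ s : ℕ → Config N q, s 0 = σ ∧ colourCount (s n) = colourCount η ∧
      ∀ k < n, (levelGraph N q β c).Adj (s k) (s (k + 1)) := by
  obtain ⟨p, hp⟩ := (reachable_map colourVector h).exists_isPath
  obtain ⟨s, hs0, hsn, hs⟩ := exists_path_of_walk hN p σ rfl
  exact ⟨p.length, by simpa using hp.length_lt.le, s, hs0, colourVector_eq_iff.1 hsn, hs⟩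

end LevelGraph

section Descent

lemma exists_empiricalMeasure_eq_hammingDist_le (hN : 0 < N) (σ : Config N q) {z : Fin q → ℝ}
    (hz : z ∈ latticeSimplex N q) :
    ∃ η, empiricalMeasure N q η = z ∧
      (hammingDist σ η : ℝ) / N ≤ q * dist z (empiricalMeasure N q σ) := by
  obtain ⟨ζ, rfl⟩ := exists_empiricalMeasure_eq hN hz
  obtain ⟨η, hη, hdist⟩ := exists_colourCount_eq_hammingDist_le (sum_colourCount ζ) σ
  refine ⟨η, (empiricalMeasure_eq_iff hN η ζ).2 hη, ?_⟩
  have hcount (k) : ((colourCount ζ k - colourCount σ k : ℕ) : ℝ) / N ≤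
      dist (empiricalMeasure N q ζ) (empiricalMeasure N q σ) := by
    refine le_trans ?_ (dist_le_pi_dist _ _ k)
    rw [Real.dist_eq, empiricalMeasure_apply, empiricalMeasure_apply, ← sub_div, abs_div,
      Nat.abs_cast]
    gcongr
    rcases le_total (colourCount ζ k) (colourCount σ k) with h | h
    · simp [Nat.sub_eq_zero_of_le h]
    · rw [Nat.cast_sub h]
      exact le_abs_self _
  calc (hammingDist σ η : ℝ) / N
      ≤ (∑ k, (colourCount ζ k - colourCount σ k) : ℕ) / N := by gcongr
    _ = ∑ k, ((colourCount ζ k - colourCount σ k : ℕ) : ℝ) / N := by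
        rw [Nat.cast_sum, Finset.sum_div]
    _ ≤ ∑ _k : Fin q, dist (empiricalMeasure N q ζ) (empiricalMeasure N q σ) :=
        Finset.sum_le_sum fun k _ => hcount k
    _ = _ := by simp

lemma dist_empiricalMeasure_le (σ η : Config N q) :
    dist (empiricalMeasure N q σ) (empiricalMeasure N q η) ≤ hammingDist σ η / N :=
  (dist_pi_le_iff (by positivity)).2 fun k => abs_empiricalMeasure_sub_le σ η k

lemma exists_reachable_of_dist_lt (hN : 0 < N) {β ε δ : ℝ}
    (hδ : ∀ x ∈ stdSimplex ℝ (Fin q), ∀ y ∈ stdSimplex ℝ (Fin q), dist x y < δ →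
      dist (freeEnergy q β x) (freeEnergy q β y) < ε) (σ : Config N q)
    {z : Fin q → ℝ} (hz : z ∈ latticeSimplex N q)
    (hzσ : 2 * q * dist z (empiricalMeasure N q σ) < δ) {c : ℝ}
    (hc : freeEnergy q β (empiricalMeasure N q σ) + ε ≤ c) :
    ∃ η, empiricalMeasure N q η = z ∧ (levelGraph N q β c).Reachable σ η := by
  obtain ⟨η, hη, hdist⟩ := exists_empiricalMeasure_eq_hammingDist_le hN σ hz
  refine ⟨η, hη, reachable_levelGraph fun τ hτ => ?_⟩
  have hτσ : dist (empiricalMeasure N q τ) (empiricalMeasure N q σ) < δ := by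
    calc dist (empiricalMeasure N q τ) (empiricalMeasure N q σ)
        ≤ hammingDist τ η / N + hammingDist σ η / N :=
          (dist_triangle_right _ _ _).trans
            (add_le_add (dist_empiricalMeasure_le τ η) (dist_empiricalMeasure_le σ η))
      _ ≤ hammingDist σ η / N + hammingDist σ η / N := by gcongr
      _ < δ := by linarith
  have hF := hδ _ (empiricalMeasure_mem_latticeSimplex hN τ).1 _
    (empiricalMeasure_mem_latticeSimplex hN σ).1 hτσ
  rw [Real.dist_eq] at hF
  linarith [(abs_lt.1 hF).2]

lemma eventually_exists_reachable_minimum (hq : 2 ≤ q) {β : ℝ} (hβ : betaOne q < β) {ε : ℝ}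
    (hε : 0 < ε) :
    ∀ᶠ N in atTop, ∀ m : indexSet q β → Fin q → ℝ,
      (∀ i : indexSet q β, IsClosestLatticePoint N q (minimum q β i) (m i)) →
      ∀ σ : Config N q, ∃ i, ∃ η : Config N q, empiricalMeasure N q η = m i ∧
        (levelGraph N q β (freeEnergy q β (empiricalMeasure N q σ) + ε)).Reachable σ η := by
  classical
  obtain ⟨δ, hδ, hF⟩ := Metric.uniformContinuousOn_iff.1
    ((isCompact_stdSimplex ℝ (Fin q)).uniformContinuousOn_of_continuous
      (continuous_freeEnergy q β).continuousOn) ε hε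
  have hq0 : (0 : ℝ) < 2 * q := by exact_mod_cast (by lia : 0 < 2 * q)
  set r := δ / (2 * q)
  have hr : 0 < r := by positivity
  filter_upwards [eventually_gt_atTop 0, eventually_exists_dist_minimum_lt hq hβ hr (half_pos hr),
    eventually_dist_lt_of_isClosestLatticePoint q (half_pos hr)] with N hN hnear hclose m hm σ
  set c := freeEnergy q β (empiricalMeasure N q σ) + ε
  set R : Finset (Config N q) := Finset.univ.filter ((levelGraph N q β c).Reachable σ) with hR
  obtain ⟨τ, hτR, hτmin⟩ := R.exists_min_image
    (fun τ => freeEnergy q β (empiricalMeasure N q τ)) ⟨σ, by simp [hR]⟩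
  have hστ : (levelGraph N q β c).Reachable σ τ := (Finset.mem_filter.1 hτR).2
  have hτc : freeEnergy q β (empiricalMeasure N q τ) + ε ≤ c := by
    linarith [hτmin σ (by simp [hR])]
  have hlocal : ∀ z ∈ latticeSimplex N q, dist z (empiricalMeasure N q τ) < r →
      freeEnergy q β (empiricalMeasure N q τ) ≤ freeEnergy q β z := fun z hz hzτ => by
    obtain ⟨η, rfl, hη⟩ := exists_reachable_of_dist_lt hN hF τ hz ((lt_div_iff₀' hq0).1 hzτ) hτc
    exact hτmin η (by simpa [hR] using hστ.trans hη)
  obtain ⟨i, hi, hτi⟩ := hnear _ (empiricalMeasure_mem_latticeSimplex hN τ) hlocal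
  have hmi := hclose _ (minimum_mem_stdSimplex hq hβ i) _ (hm ⟨i, hi⟩)
  have hmτ : dist (m ⟨i, hi⟩) (empiricalMeasure N q τ) < r := by
    linarith [dist_triangle_right (m ⟨i, hi⟩) (empiricalMeasure N q τ) (minimum q β i)]
  obtain ⟨η, hη, hτη⟩ := exists_reachable_of_dist_lt hN hF τ (hm ⟨i, hi⟩).1
    ((lt_div_iff₀' hq0).1 hmτ) hτc
  exact ⟨⟨i, hi⟩, η, hη, hστ.trans hτη⟩

end Descent

section Mass

variable {β : ℝ≥0}

lemma gibbs_real_pos {A : Set (Config N q)} (hA : A.Nonempty) : 0 < (gibbs N q β).real A := by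
  obtain ⟨σ, hσ⟩ := hA
  calc 0 < gibbsWeight N q β σ := gibbsWeight_pos β σ
    _ = (gibbs N q β).real {σ} := (gibbs_real_singleton β σ).symm
    _ ≤ (gibbs N q β).real A := measureReal_mono (singleton_subset_iff.2 hσ)

lemma escapeProb_mul_gibbs_real {A B : Set (Config N q)} (hAB : Disjoint A B) (hA : A.Nonempty) :
    MarkovChain.escapeProb (glauber N q β) (gibbs N q β) A B * (gibbs N q β).real A =
      MarkovChain.capacity (glauber N q β) (gibbsWeight N q β) A B := by
  have hw : (fun σ => (gibbs N q β).real {σ}) = gibbsWeight N q β :=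
    funext fun σ => gibbs_real_singleton β σ
  rw [← hw]
  exact MarkovChain.escapeProb_mul_real_eq_capacity _ (hw ▸ isReversible_glauber β) hAB
    ((measureReal_ne_zero_iff).1 (gibbs_real_pos hA).ne')

lemma gibbs_real_le_of_forall_inter_colourClass_le {A : Set (Config N q)} {T : ℝ} (hT : 0 ≤ T)
    (h : ∀ σ ∈ A, (gibbs N q β).real (A ∩ colourClass σ) ≤ T) :
    (gibbs N q β).real A ≤ (N + 1) ^ q * T := by
  have hcover : A = ⋃ v, A ∩ colourVector ⁻¹' {v} := by
    rw [← inter_iUnion, ← preimage_iUnion, iUnion_of_singleton, preimage_univ, inter_univ]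
  have hfibre (v) : (gibbs N q β).real (A ∩ colourVector ⁻¹' {v}) ≤ T := by
    rcases (A ∩ colourVector ⁻¹' {v}).eq_empty_or_nonempty with hv | ⟨σ, hσ, rfl⟩
    · rwa [hv, measureReal_empty]
    · convert h σ hσ using 3
      ext η
      simp [colourVector_eq_iff, mem_colourClass]
  calc (gibbs N q β).real A ≤ ∑ v, (gibbs N q β).real (A ∩ colourVector ⁻¹' {v}) := by
        conv_lhs => rw [hcover]
        exact measureReal_iUnion_fintype_le _
    _ ≤ ∑ _v : Fin q → Fin (N + 1), T := Finset.sum_le_sum fun v _ => hfibre v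
    _ = (N + 1) ^ q * T := by simp

lemma gibbs_real_eq_card_mul (hN : 0 < N) {σ : Config N q} {X : Finset (Config N q)}
    (hX : X ⊆ colourClass σ) : (gibbs N q β).real X = X.card * gibbsWeight N q β σ := by
  rw [← sum_measureReal_singleton, ← nsmul_eq_mul, ← Finset.sum_const]
  refine Finset.sum_congr rfl fun η hη => ?_
  rw [gibbs_real_singleton, gibbsWeight_congr hN β (mem_colourClass.1 (hX hη))]

lemma gibbs_real_colourClass_le (hN : 0 < N) (hβ : 0 < β) (σ τ : Config N q) :
    (gibbs N q β).real (colourClass σ) ≤ (Real.exp 1 * (N + 1)) ^ q *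
      Real.exp (β * N * (freeEnergy q β (empiricalMeasure N q τ) -
        freeEnergy q β (empiricalMeasure N q σ))) * (gibbs N q β).real (colourClass τ) := by
  have hσ := symmetryCount_mul_card_colourClass σ
  have hτ := symmetryCount_mul_card_colourClass τ
  have hσ0 : (0 : ℝ) < symmetryCount σ := by exact_mod_cast symmetryCount_pos σ
  have hτ0 : (0 : ℝ) < symmetryCount τ := by exact_mod_cast symmetryCount_pos τ
  rw [gibbs_real_eq_card_mul hN subset_rfl, gibbs_real_eq_card_mul hN subset_rfl]
  set K := (Real.exp 1 * (N + 1)) ^ q * Real.exp (β * N * (freeEnergy q β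
    (empiricalMeasure N q τ) - freeEnergy q β (empiricalMeasure N q σ)))
  refine le_of_mul_le_mul_left ?_ (mul_pos hσ0 hτ0)
  calc (symmetryCount σ : ℝ) * symmetryCount τ * ((colourClass σ).card * gibbsWeight N q β σ)
      = N.factorial * (gibbsWeight N q β σ * symmetryCount τ) := by rw [← hσ]; ring
    _ ≤ N.factorial * (K * (gibbsWeight N q β τ * symmetryCount σ)) :=
        mul_le_mul_of_nonneg_left (gibbsWeight_mul_symmetryCount_le hN hβ σ τ) (by positivity)
    _ = _ := by rw [← hτ]; ring

lemma gibbs_real_le_of_add_le_freeEnergy (hN : 0 < N) (hβ : 0 < β) {A : Set (Config N q)}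
    (τ : Config N q) {δ : ℝ}
    (h : ∀ σ ∈ A, freeEnergy q β (empiricalMeasure N q τ) + δ ≤
      freeEnergy q β (empiricalMeasure N q σ)) :
    (gibbs N q β).real A ≤ (N + 1) ^ q * ((Real.exp 1 * (N + 1)) ^ q *
      Real.exp (-(β * N * δ)) * (gibbs N q β).real (colourClass τ)) := by
  refine gibbs_real_le_of_forall_inter_colourClass_le (by positivity) fun σ hσ => ?_
  refine (measureReal_mono inter_subset_right).trans
    ((gibbs_real_colourClass_le hN hβ σ τ).trans ?_)
  rw [← mul_neg]
  gcongr
  linarith [h σ hσ]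

end Mass

section Escape

variable {β : ℝ≥0}

lemma gibbs_real_inter_colourClass_le_capacity (hN : 0 < N) (hβ : 0 < β) {ε : ℝ}
    {M X : Set (Config N q)} (hXM : Disjoint X M) {σ η : Config N q}
    (hM : (colourClass η : Set (Config N q)) ⊆ M)
    (h : (levelGraph N q β (freeEnergy q β (empiricalMeasure N q σ) + ε)).Reachable σ η) :
    (gibbs N q β).real (X ∩ colourClass σ) ≤
      ((N + 1) ^ q) ^ 2 * ((Real.exp 1 * (N + 1)) ^ q * Real.exp (β * N * ε)) *
        (2 * N * q * Real.exp (β * q) *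
          MarkovChain.capacity (glauber N q β) (gibbsWeight N q β) X M) := by
  classical
  obtain ⟨n, hn, s, rfl, hsn, hs⟩ := exists_path_of_reachable hN h
  set Y : Finset (Config N q) := {τ ∈ colourClass (s 0) | τ ∈ X} with hY
  have hYX : X ∩ colourClass (s 0) = Y := by
    ext τ
    simp [hY, and_comm]
  have hcap : 0 ≤ MarkovChain.capacity (glauber N q β) (gibbsWeight N q β) X M :=
    MarkovChain.dirichletForm_self_nonneg (fun σ => (gibbsWeight_pos β σ).le) _
  have hn' : (n : ℝ) ≤ (N + 1) ^ q := by exact_mod_cast hn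
  rw [hYX, gibbs_real_eq_card_mul hN (Finset.filter_subset _ _)]
  refine (card_mul_gibbsWeight_le (u := MarkovChain.potential (glauber N q β) X M) hN hβ
    (fun k hk => (hs k hk).1) (fun k hk => (hs k hk).2.1) (Finset.filter_subset _ _)
    (fun τ hτ => MarkovChain.potential_of_mem_left _ (Finset.mem_filter.1 hτ).2)
    fun τ hτ => MarkovChain.potential_of_mem_right _ hXM
      (hM (mem_colourClass.2 ((mem_colourClass.1 hτ).trans hsn)))).trans ?_
  rw [← MarkovChain.capacity]
  gcongr

lemma one_le_mul_escapeProb (hN : 0 < N) (hβ : 0 < β) {ε : ℝ} {M X : Set (Config N q)}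
    (hX : X.Nonempty) (hXM : Disjoint X M)
    (hreach : ∀ σ : Config N q, ∃ η, (colourClass η : Set (Config N q)) ⊆ M ∧
      (levelGraph N q β (freeEnergy q β (empiricalMeasure N q σ) + ε)).Reachable σ η) :
    1 ≤ (N + 1) ^ q * (((N + 1) ^ q) ^ 2 * ((Real.exp 1 * (N + 1)) ^ q *
      Real.exp (β * N * ε)) * (2 * N * q * Real.exp (β * q))) *
        MarkovChain.escapeProb (glauber N q β) (gibbs N q β) X M := by
  refine le_of_mul_le_mul_right ?_ (gibbs_real_pos (β := β) hX)
  rw [one_mul, mul_assoc _ (MarkovChain.escapeProb _ _ _ _), escapeProb_mul_gibbs_real hXM hX,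
    mul_assoc]
  have hcap : 0 ≤ MarkovChain.capacity (glauber N q β) (gibbsWeight N q β) X M :=
    MarkovChain.dirichletForm_self_nonneg (fun σ => (gibbsWeight_pos β σ).le) _
  refine gibbs_real_le_of_forall_inter_colourClass_le (by positivity) fun σ _ => ?_
  obtain ⟨η, hηM, hη⟩ := hreach σ
  rw [mul_assoc]
  exact gibbs_real_inter_colourClass_le_capacity hN hβ hXM hηM hη

open Classical in
lemma dirichletForm_ite_mem_le {A B : Set (Config N q)}
    (h : ∀ σ η, hammingDist σ η = 1 → (σ ∈ A ↔ η ∉ A) → σ ∈ B) :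
    MarkovChain.dirichletForm (glauber N q β) (gibbsWeight N q β)
      (fun σ => if σ ∈ A then 0 else 1) (fun σ => if σ ∈ A then 0 else 1) ≤
        (gibbs N q β).real B := by
  set v : Config N q → ℝ := fun σ => if σ ∈ A then 0 else 1 with hv
  have hv1 (σ η) : (v σ - v η) * (v σ - v η) ≤ 1 := by
    simp only [hv]
    split_ifs <;> norm_num
  have hv0 {σ η} (hσ : σ ∉ B) :
      gibbsWeight N q β σ * (glauber N q β).1 σ η * ((v σ - v η) * (v σ - v η)) = 0 := by
    by_cases hiff : σ ∈ A ↔ η ∈ A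
    · simp [hv, hiff]
    · have hne : σ ≠ η := by rintro rfl; exact hiff Iff.rfl
      rw [glauber_eq_zero β hne fun h1 => hσ (h σ η h1 (by tauto)), mul_zero, zero_mul]
  have hP := (glauber N q β).2.1
  calc _ ≤ ∑ σ, ∑ η, gibbsWeight N q β σ * (glauber N q β).1 σ η *
          ((v σ - v η) * (v σ - v η)) :=
        mul_le_of_le_one_left (Finset.sum_nonneg fun σ _ => Finset.sum_nonneg fun η _ =>
          mul_nonneg (mul_nonneg (gibbsWeight_pos β σ).le (hP σ η)) (mul_self_nonneg _))
          (by norm_num)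
    _ = ∑ σ with σ ∈ B, ∑ η, gibbsWeight N q β σ * (glauber N q β).1 σ η *
          ((v σ - v η) * (v σ - v η)) :=
        (Finset.sum_filter_of_ne fun σ _ hσ => by
          by_contra hB
          exact hσ (Finset.sum_eq_zero fun η _ => hv0 hB)).symm
    _ ≤ ∑ σ with σ ∈ B, ∑ η, gibbsWeight N q β σ * (glauber N q β).1 σ η :=
        Finset.sum_le_sum fun σ _ => Finset.sum_le_sum fun η _ =>
          mul_le_of_le_one_right (mul_nonneg (gibbsWeight_pos β σ).le (hP σ η)) (hv1 σ η)
    _ = (gibbs N q β).real B := by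
        simp only [gibbs_real_eq_sum, ← Finset.mul_sum,
          Matrix.sum_row_of_mem_rowStochastic (glauber N q β).2, mul_one]

end Escape

section Barrier

lemma exists_forall_abs_dist_sub_le_add_le {E : Type*} [MetricSpace E] {K : Set E}
    (hK : IsCompact K) {f : E → ℝ} (hf : ContinuousOn f K) {x : E}
    (hx : ∀ᶠ y in 𝓝 x, y ∈ K → y ≠ x → f x < f y) {ρ : ℝ} (hρ : 0 < ρ) :
    ∃ r > 0, r ≤ ρ ∧ ∃ δ > 0, ∀ y ∈ K, |dist y x - r| ≤ r / 2 → f x + δ ≤ f y := by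
  obtain ⟨R, hR, hlt⟩ := Metric.eventually_nhds_iff.1 hx
  obtain ⟨r, hr, hrmin⟩ := exists_between (lt_min hρ (half_pos hR))
  have hrR : r < R / 2 := hrmin.trans_le (min_le_right _ _)
  refine ⟨r, hr, (hrmin.trans_le (min_le_left _ _)).le, ?_⟩
  have hcont : Continuous fun y => |dist y x - r| := by fun_prop
  have hshell : IsCompact (K ∩ {y | |dist y x - r| ≤ r / 2}) :=
    hK.inter_right (isClosed_le hcont continuous_const)
  rcases (K ∩ {y | |dist y x - r| ≤ r / 2}).eq_empty_or_nonempty with hempty | hne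
  · exact ⟨1, one_pos, fun y hy hyr => absurd ⟨hy, hyr⟩ (eq_empty_iff_forall_notMem.1 hempty y)⟩
  · obtain ⟨z, ⟨hzK, hzr : |dist z x - r| ≤ r / 2⟩, hzmin⟩ := hshell.exists_isMinOn hne
      (hf.mono inter_subset_left)
    have hzr := abs_le.1 hzr
    have hzx : z ≠ x := fun h => by linarith [dist_eq_zero.2 h]
    have hfz : f x < f z := hlt (by linarith) hzK hzx
    refine ⟨f z - f x, sub_pos.2 hfz, fun y hy hyr => ?_⟩
    have hzy : f z ≤ f y := hzmin ⟨hy, hyr⟩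
    linarith

lemma coe_colourClass (hN : 0 < N) (σ : Config N q) :
    (colourClass σ : Set (Config N q)) = empiricalMeasure N q ⁻¹' {empiricalMeasure N q σ} := by
  ext η
  simp [mem_colourClass, empiricalMeasure_eq_iff hN]

/-- The test function is the indicator of the complement of a ball; the edges on which it changes
leave the `1 / N`-neighbourhood of the sphere. -/
lemma capacity_le_gibbs_real_shell {β : ℝ≥0} {A B : Set (Config N q)} {x : Fin q → ℝ} {r : ℝ}
    (hA : ∀ σ ∈ A, dist (empiricalMeasure N q σ) x < r)
    (hB : ∀ σ ∈ B, r ≤ dist (empiricalMeasure N q σ) x) :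
    MarkovChain.capacity (glauber N q β) (gibbsWeight N q β) A B ≤
      (gibbs N q β).real {σ | |dist (empiricalMeasure N q σ) x - r| ≤ 1 / N} := by
  classical
  have hAB : Disjoint A B := disjoint_left.2 fun σ hσA hσB => (hA σ hσA).not_ge (hB σ hσB)
  refine (MarkovChain.capacity_le_dirichletForm (isReversible_glauber β)
    (fun σ => (gibbsWeight_pos β σ).le) hAB
    (v := fun σ => if σ ∈ {σ | dist (empiricalMeasure N q σ) x < r} then 0 else 1)
    (fun σ hσ => if_pos (hA σ hσ)) fun σ hσ => if_neg (hB σ hσ).not_gt).trans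
    (dirichletForm_ite_mem_le fun σ η h hcross => ?_)
  have hστ := (abs_dist_sub_le _ _ x).trans (dist_empiricalMeasure_le σ η)
  rw [h, Nat.cast_one, abs_le] at hστ
  simp only [mem_ofPred_eq, not_lt] at hcross
  rw [mem_ofPred_eq, abs_le]
  rcases lt_or_ge (dist (empiricalMeasure N q σ) x) r with hσ | hσ
  · have := hcross.1 hσ
    constructor <;> linarith
  · have := lt_of_not_ge fun hη => (hcross.2 hη).not_ge hσ
    constructor <;> linarith

lemma escapeProb_le_of_barrier (hN : 0 < N) {β : ℝ≥0} (hβ : 0 < β) {x : Fin q → ℝ} {r δ : ℝ}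
    {τ : Config N q} (hτ : dist (empiricalMeasure N q τ) x < r) {B : Set (Config N q)}
    (hB : ∀ σ ∈ B, r ≤ dist (empiricalMeasure N q σ) x)
    (hbarrier : ∀ y ∈ stdSimplex ℝ (Fin q), |dist y x - r| ≤ 1 / N →
      freeEnergy q β (empiricalMeasure N q τ) + δ ≤ freeEnergy q β y) :
    MarkovChain.escapeProb (glauber N q β) (gibbs N q β) (colourClass τ) B ≤
      (N + 1) ^ q * ((Real.exp 1 * (N + 1)) ^ q * Real.exp (-(β * N * δ))) := by
  have hne : (colourClass τ : Set (Config N q)).Nonempty := ⟨τ, mem_colourClass.2 rfl⟩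
  have hA : ∀ σ ∈ (colourClass τ : Set (Config N q)), dist (empiricalMeasure N q σ) x < r := by
    rw [coe_colourClass hN]
    rintro σ (hσ : empiricalMeasure N q σ = empiricalMeasure N q τ)
    rwa [hσ]
  have hAB : Disjoint (colourClass τ : Set (Config N q)) B :=
    disjoint_left.2 fun σ hσA hσB => (hA σ hσA).not_ge (hB σ hσB)
  refine le_of_mul_le_mul_right ?_ (gibbs_real_pos (β := β) hne)
  rw [escapeProb_mul_gibbs_real hAB hne, mul_assoc]
  exact (capacity_le_gibbs_real_shell hA hB).trans (gibbs_real_le_of_add_le_freeEnergy hN hβ τ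
    fun σ hσ => hbarrier _ (empiricalMeasure_mem_latticeSimplex hN σ).1 hσ)

end Barrier

section Asymptotics

lemma eventually_mul_pow_le_exp (C : ℝ) (p : ℕ) {κ : ℝ} (hκ : 0 < κ) :
    ∀ᶠ N : ℕ in atTop, C * ((N : ℝ) + 1) ^ p ≤ Real.exp (κ * N) := by
  have hlim : Tendsto (fun N : ℕ => (N : ℝ) + 1) atTop atTop :=
    tendsto_atTop_add_const_right _ _ tendsto_natCast_atTop_atTop
  filter_upwards [(((isLittleO_pow_exp_pos_mul_atTop p hκ).const_mul_left C).comp_tendsto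
    hlim).bound (Real.exp_pos (-κ))] with N hN
  calc C * ((N : ℝ) + 1) ^ p ≤ Real.exp (-κ) * Real.exp (κ * (N + 1)) :=
        (le_abs_self _).trans (by simpa using hN)
    _ = Real.exp (κ * N) := by rw [← Real.exp_add]; ring_nf

lemma exists_pos_forall_le_dist_minimum (hq : 2 ≤ q) {β : ℝ} (hβ : betaOne q < β) :
    ∃ ρ > 0, ∀ i j, i ≠ j → ρ ≤ dist (minimum q β i) (minimum q β j) := by
  have : NeZero q := ⟨by lia⟩
  have hinj := minimum_injective hq hβ
  have hnt : (range (minimum q β)).Nontrivial := by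
    rw [← image_univ]
    exact nontrivial_univ.image hinj
  exact ⟨(range (minimum q β)).infsep, infsep_pos_iff_nontrivial_of_finite.2 hnt,
    fun i j hij => infsep_le_dist_of_mem (mem_range_self i) (mem_range_self j) (hinj.ne hij)⟩

lemma eventually_injective_closestLatticePoint (hq : 2 ≤ q) {β : ℝ} (hβ : betaOne q < β) :
    ∀ᶠ N in atTop, ∀ m : indexSet q β → Fin q → ℝ,
      (∀ i : indexSet q β, IsClosestLatticePoint N q (minimum q β i) (m i)) →
      Function.Injective m := by
  obtain ⟨ρ, hρ, hsep⟩ := exists_pos_forall_le_dist_minimum hq hβ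
  filter_upwards [eventually_dist_lt_of_isClosestLatticePoint q (half_pos hρ)]
    with N hclose m hm i j hij
  by_contra hne
  have hi := hclose _ (minimum_mem_stdSimplex hq hβ i) _ (hm i)
  have hj := hclose _ (minimum_mem_stdSimplex hq hβ j) _ (hm j)
  rw [hij] at hi
  linarith [hsep i j fun h => hne (Subtype.ext h),
    dist_triangle_left (minimum q β i) (minimum q β j) (m j)]

lemma eventually_nonempty_compl_iUnion_preimage (hq : 2 ≤ q) {β : ℝ} (hβ : betaOne q < β) :
    ∀ᶠ N in atTop, ∀ m : indexSet q β → Fin q → ℝ,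
      (∀ i : indexSet q β, IsClosestLatticePoint N q (minimum q β i) (m i)) →
      (⋃ i, empiricalMeasure N q ⁻¹' {m i})ᶜ.Nonempty := by
  let k : Fin q := ⟨0, by lia⟩
  obtain ⟨i₀, hi₀⟩ := Finite.exists_max fun i => minimum q β i k
  filter_upwards [eventually_gt_atTop 0, eventually_dist_lt_of_isClosestLatticePoint q
    (sub_pos.2 (minimum_lt_one hq hβ i₀ k))] with N hN hclose m hm
  refine ⟨fun _ => k, fun hmem => ?_⟩
  obtain ⟨i, hi : _ = m i⟩ := mem_iUnion.1 hmem
  have hmono : m i k = 1 := by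
    rw [← hi]
    simp [empiricalMeasure, hN.ne']
  have hik := (dist_le_pi_dist (m i) (minimum q β i) k).trans_lt
    (hclose _ (minimum_mem_stdSimplex hq hβ i) _ (hm i))
  rw [hmono, Real.dist_eq] at hik
  linarith [hi₀ i, le_abs_self (1 - minimum q β i k)]

lemma exists_eventually_escapeProb_le (hq : 2 ≤ q) {β : ℝ≥0} (hβ : betaOne q < β)
    (j : indexSet q β) :
    ∃ δ > 0, ∀ᶠ N in atTop, ∀ m : indexSet q β → Fin q → ℝ,
      (∀ i : indexSet q β, IsClosestLatticePoint N q (minimum q β i) (m i)) →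
      MarkovChain.escapeProb (glauber N q β) (gibbs N q β) (empiricalMeasure N q ⁻¹' {m j})
        ((⋃ i, empiricalMeasure N q ⁻¹' {m i}) \ empiricalMeasure N q ⁻¹' {m j}) ≤
      (N + 1) ^ q * ((Real.exp 1 * (N + 1)) ^ q * Real.exp (-(β * N * δ))) := by
  have hβ0 : 0 < β := by exact_mod_cast pos_of_betaOne_lt hq hβ
  obtain ⟨ρ, hρ, hsep⟩ := exists_pos_forall_le_dist_minimum hq hβ
  obtain ⟨r, hr, hrρ, δ, hδ, hbarrier⟩ := exists_forall_abs_dist_sub_le_add_le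
    (isCompact_stdSimplex ℝ (Fin q)) (continuous_freeEnergy q β).continuousOn
    (eventually_freeEnergy_minimum_lt hq hβ j.2) (half_pos hρ)
  obtain ⟨θ, hθ, hcont⟩ := Metric.continuous_iff.1 (continuous_freeEnergy q β)
    (minimum q β j) (δ / 2) (half_pos hδ)
  refine ⟨δ / 2, half_pos hδ, ?_⟩
  filter_upwards [eventually_gt_atTop 0, eventually_dist_lt_of_isClosestLatticePoint q
    (lt_min hθ (lt_min hr (half_pos hρ))),
    tendsto_one_div_atTop_nhds_zero_nat.eventually_le_const (half_pos hr)]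
    with N hN hclose hNr m hm
  have hclose (i : indexSet q β) := hclose _ (minimum_mem_stdSimplex hq hβ i) _ (hm i)
  simp only [lt_min_iff] at hclose
  obtain ⟨τ, hτ⟩ := exists_empiricalMeasure_eq hN (hm j).1
  have hFτ := (abs_lt.1 (hcont _ (hclose j).1)).2
  rw [← hτ] at hFτ
  nth_rw 1 [← hτ]
  rw [← coe_colourClass hN]
  refine escapeProb_le_of_barrier hN hβ0 (hτ ▸ (hclose j).2.1) ?_ fun y hy hyr => by
    linarith [hbarrier y hy (hyr.trans hNr)]
  rintro σ ⟨hσ, hσj⟩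
  obtain ⟨i, hi : _ = m i⟩ := mem_iUnion.1 hσ
  have hij : i ≠ j := by rintro rfl; exact hσj hi
  rw [hi]
  linarith [hsep i j fun h => hij (Subtype.ext h), (hclose i).2.2,
    dist_triangle_left (minimum q β i) (minimum q β j) (m i)]

end Asymptotics

section ExponentialBounds

variable {β : ℝ≥0}

lemma exists_eventually_escapeProb_le_exp (hq : 2 ≤ q) (hβ : betaOne q < β) :
    ∃ κ > 0, ∀ᶠ N : ℕ in atTop, ∀ m : indexSet q β → Fin q → ℝ,
      (∀ i : indexSet q β, IsClosestLatticePoint N q (minimum q β i) (m i)) → ∀ j,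
      MarkovChain.escapeProb (glauber N q β) (gibbs N q β) (empiricalMeasure N q ⁻¹' {m j})
        ((⋃ i, empiricalMeasure N q ⁻¹' {m i}) \ empiricalMeasure N q ⁻¹' {m j}) ≤
      Real.exp (-κ * N) := by
  have hβ0 : (0 : ℝ) < β := pos_of_betaOne_lt hq hβ
  choose δ hδ hesc using fun j => exists_eventually_escapeProb_le hq hβ j
  have : Nonempty (indexSet q β) := ⟨⟨_, some_mem_indexSet ⟨0, by lia⟩⟩⟩
  obtain ⟨j₀, hj₀⟩ := Finite.exists_min δ
  have hκ : 0 < β * δ j₀ / 2 := by have := hδ j₀; positivity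
  refine ⟨β * δ j₀ / 2, hκ, ?_⟩
  filter_upwards [eventually_all.2 hesc, eventually_mul_pow_le_exp (Real.exp 1 ^ q) (2 * q) hκ]
    with N hescN hpoly m hm j
  calc _ ≤ (N + 1) ^ q * ((Real.exp 1 * (N + 1)) ^ q * Real.exp (-(β * N * δ j))) :=
        hescN j m hm
    _ ≤ (N + 1) ^ q * ((Real.exp 1 * (N + 1)) ^ q * Real.exp (-(β * N * δ j₀))) := by
        gcongr
        exact hj₀ j
    _ = Real.exp 1 ^ q * ((N : ℝ) + 1) ^ (2 * q) * Real.exp (-(β * N * δ j₀)) := by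
        rw [mul_pow]; ring
    _ ≤ Real.exp (β * δ j₀ / 2 * N) * Real.exp (-(β * N * δ j₀)) := by gcongr
    _ = Real.exp (-(β * δ j₀ / 2) * N) := by rw [← Real.exp_add]; ring_nf

lemma eventually_exp_le_escapeProb (hq : 2 ≤ q) (hβ : betaOne q < β) {κ : ℝ} (hκ : 0 < κ) :
    ∀ᶠ N : ℕ in atTop, ∀ m : indexSet q β → Fin q → ℝ,
      (∀ i : indexSet q β, IsClosestLatticePoint N q (minimum q β i) (m i)) →
      ∀ X : Set (Config N q), X.Nonempty → X ⊆ (⋃ i, empiricalMeasure N q ⁻¹' {m i})ᶜ →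
      Real.exp (-κ * N) ≤ MarkovChain.escapeProb (glauber N q β) (gibbs N q β) X
        (⋃ i, empiricalMeasure N q ⁻¹' {m i}) := by
  have hβ0 : (0 : ℝ) < β := pos_of_betaOne_lt hq hβ
  set ε := κ / (2 * β) with hε
  filter_upwards [eventually_gt_atTop 0,
    eventually_exists_reachable_minimum hq hβ (by positivity : 0 < ε),
    eventually_mul_pow_le_exp (2 * Real.exp 1 ^ q * q * Real.exp (β * q)) (4 * q + 1)
      (half_pos hκ)] with N hN hreach hpoly m hm X hX hXM
  have hesc := one_le_mul_escapeProb hN (by exact_mod_cast hβ0) hX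
    (Set.disjoint_left.2 fun _ hσ hσM => hXM hσ hσM) fun σ => by
      obtain ⟨i, η, hη, hση⟩ := hreach m hm σ
      refine ⟨η, ?_, hση⟩
      rw [coe_colourClass hN, hη]
      exact Set.subset_iUnion (fun i => empiricalMeasure N q ⁻¹' {m i}) i
  have hfactor : ((N : ℝ) + 1) ^ q * (((N + 1) ^ q) ^ 2 * ((Real.exp 1 * (N + 1)) ^ q *
      Real.exp (β * N * ε)) * (2 * N * q * Real.exp (β * q))) ≤ Real.exp (κ * N) := by
    calc _ = 2 * Real.exp 1 ^ q * q * Real.exp (β * q) * (((N : ℝ) + 1) ^ (4 * q) * N) *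
          Real.exp (κ / 2 * N) := by
          rw [show β * N * ε = κ / 2 * N by rw [hε]; field_simp, mul_pow (Real.exp 1)]
          ring
      _ ≤ 2 * Real.exp 1 ^ q * q * Real.exp (β * q) * (((N : ℝ) + 1) ^ (4 * q + 1)) *
          Real.exp (κ / 2 * N) := by
          rw [pow_succ _ (4 * q)]
          gcongr
          linarith
      _ ≤ Real.exp (κ / 2 * N) * Real.exp (κ / 2 * N) := by gcongr
      _ = Real.exp (κ * N) := by rw [← Real.exp_add]; ring_nf
  rw [neg_mul, Real.exp_neg, inv_le_iff_one_le_mul₀' (Real.exp_pos _)]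
  exact hesc.trans (mul_le_mul_of_nonneg_right hfactor measureReal_nonneg)

end ExponentialBounds

end CWP

theorem theorem1 (q : ℕ) (hq : 2 ≤ q) (β : ℝ≥0) (hβ : CWP.betaOne q < (β : ℝ)) :
    ∃ k₁ : ℝ, 0 < k₁ ∧ ∃ N₀ : ℕ, ∀ N : ℕ, N₀ < N →
      ∀ m : CWP.indexSet q β → Fin q → ℝ,
        (∀ i : CWP.indexSet q β, CWP.IsClosestLatticePoint N q (CWP.minimum q β i) (m i)) →
        MarkovChain.IsMetastable (CWP.glauber N q β) (CWP.gibbs N q β) (Real.exp (-k₁ * N))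
          (fun i : CWP.indexSet q β => CWP.empiricalMeasure N q ⁻¹' {m i}) := by
  obtain ⟨κ, hκ, hout⟩ := CWP.exists_eventually_escapeProb_le_exp hq hβ
  have hκ' : 0 < κ / 3 := by positivity
  suffices h : _ from ⟨κ / 3, hκ', (Filter.eventually_atTop.1 h).imp fun _ h N hN => h N hN.le⟩
  filter_upwards [hout, CWP.eventually_exp_le_escapeProb hq hβ hκ', Filter.eventually_gt_atTop 0,
    CWP.eventually_injective_closestLatticePoint hq hβ,
    CWP.eventually_nonempty_compl_iUnion_preimage hq hβ,
    CWP.eventually_mul_pow_le_exp (Fintype.card (CWP.indexSet q β)) 0 hκ']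
    with N houtN hinN hN hinj hcompl hcard m hm
  refine MarkovChain.isMetastable_of_escapeProb_le
    (fun i => CWP.exists_empiricalMeasure_eq hN (hm i).1)
    (fun i j hij => (Set.disjoint_singleton.2 ((hinj m hm).ne hij)).preimage _) (hcompl m hm)
    (Real.exp_pos _).le (Real.exp_pos _) (houtN m hm) (hinN m hm) ?_
  rw [← Real.exp_sub]
  calc _ ≤ Real.exp (κ / 3 * N) * Real.exp (-κ * N - -(κ / 3) * N) := by
        gcongr
        simpa using hcard
    _ = Real.exp (-(κ / 3) * N) := by rw [← Real.exp_add]; ring_nf
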